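/- Let $s\ge 1$, let $R$ be a commutative ring with unit (for instance a commutative unital algebra over a field $k$ of characteristic zero), and let $[s]^*_+$ be the set of nonempty words $w=(i_1\dots i_n)$ in the alphabet $\{1,\dots,s\}$. Let $R\langle\langle x_1,\dots,x_s\rangle\rangle_+$ be the set of families $f=(f_w)_{w\in[s]^*_+}$ in $R$ (power series in non-commuting variables without constant term), and let $\mathfrak G^s(R)$ be the subset of those $f$ for which $f_i\in R^\times$ for every one-letter word $i$. Identify such an $f$ with the linear functional on $R\langle x_1,\dots,x_s\rangle$ given by $f(1)=1$ and $f(x_{i_1}\cdots x_{i_n})=f_{(i_1\dots i_n)}$. *Free product.* For linear functionals $f,g$ on $R\langle x_1,\dots,x_s\rangle$, the free product $f\bullet_F g$ is the linear functional on $R\langle x_1,\dots,x_s\rangle\amalg_1 R\langle x_1,\dots,x_s\rangle\cong R\langle x_1,\dots,x_s,y_1,\dots,y_s\rangle$ with $f\bullet_F g(1)=1$ which, on a word $a_1a_2\cdots a_m$ ($m\ge1$) written as an alternating product of nonempty words $a_j$ in the $x_i$ only ($\epsilon_j=1$) or in the $y_i$ only ($\epsilon_j=2$), is given recursively by $$f\bullet_F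 g(a_1\cdots a_m)=\sum_{I\subsetneq\{1,\dots,m\}}(-1)^{m-|I|+1}\, f\bullet_F g\Big(\prod_{i\in I}a_i\Big)\prod_{i\notin I}\varphi_{\epsilon_i}(a_i),\qquad \varphi_1=f,\ \varphi_2=g,$$ where $\prod_{i\in I}a_i$ is taken in the given order (and $g$ is applied to words in the $y_i$ by reading $y_i$ as $x_i$). Let $\Delta_m: R\langle x_1,\dots,x_s\rangle\to R\langle x_1,\dots,x_s,y_1,\dots,y_s\rangle$ be the homomorphism of unital algebras with $\Delta_m(x_i)=x_iy_i$. *Boxed convolution.* For $f,g\in R\langle\langle x_1,\dots,x_s\rangle\rangle_+$ and $w=(i_1\dots i_n)$, $n\ge1$, put $$(f\boxtimes g)_w=\sum_{\pi\in \mathrm{NC}(n)}\ \prod_{V\in\pi}f_{w|V}\prod_{V\in K(\pi)}g_{w|V},$$ where $\mathrm{NC}(n)$ is the set of non-crossing partitions of $\{1,\dots,n\}$, $K(\pi)$ is the Kreweras complement of $\pi$ (the largest partition of copies $1',\dots,n'$ whose union with $\pi$ is non-crossing for the order $1<1'<2<2'<\dots<n<n'$), and $w|V=(i_{v_1}\dots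 i_{v_r})$ for $V=\{v_1<\dots<v_r\}$. Let $\mathrm{Zeta}$ be the series with $\mathrm{Zeta}_w=1$ for all $w\in[s]^*_+$. **Proposition.** There is exactly one series $\mathrm{Moeb}\in R\langle\langle x_1,\dots,x_s\rangle\rangle_+$ with $\mathrm{Zeta}\boxtimes\mathrm{Moeb}=x_1+\dots+x_s=\mathrm{Moeb}\boxtimes\mathrm{Zeta}$, and for all $f,g\in\mathfrak G^s(R)$ $$(f\bullet_F g)\circ\Delta_m=f\boxtimes\mathrm{Moeb}\boxtimes g$$ as linear functionals on $R\langle x_1,\dots,x_s\rangle$, where the two bracketings $(f\boxtimes\mathrm{Moeb})\boxtimes g$ and $f\boxtimes(\mathrm{Moeb}\boxtimes g)$ of the right-hand side agree. -/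

import Mathlib

open scoped BigOperators

noncomputable section

namespace FreeConv

/-! ### Words and power series without constant term -/

/-- Nonempty words in the alphabet `[s]`. -/
abbrev Word (s : ℕ) : Type := {w : List (Fin s) // w ≠ []}

/-- Power series in `s` non-commuting variables without constant term,
given by their coefficients at the nonempty words. -/
abbrev Series (s : ℕ) (R : Type*) : Type _ := Word s → R

/-- The one-letter word `i`. -/
def letter {s : ℕ} (i : Fin s) : Word s := ⟨[i], List.cons_ne_nil i []⟩

/-- The set `𝔊^s(R)` of the series whose coefficients at the one-letter words are units of `R`. -/
def unitSeries (s : ℕ) (R : Type*) [CommRing R] : Set (Series s R) :=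
  {f | ∀ i : Fin s, IsUnit (f (letter i))}

/-! ### Non-crossing partitions and the Kreweras complement -/

/-- A (partial equivalence) relation on a linearly ordered set is non-crossing if there are no
`a < b < c < d` with `a, c` in one class and `b, d` in another one. -/
def NonCrossingRel {α : Type*} [LinearOrder α] (r : α → α → Prop) : Prop :=
  ∀ a b c d : α, a < b → b < c → c < d → r a c → r b d → r a b

/-- `i` and `j` lie in the same block of the partition `π` of `{0, …, n - 1}`. -/
def SameBlock {n : ℕ} (π : Finpartition (Finset.univ : Finset (Fin n))) (i j : Fin n) : Prop :=
  ∃ V ∈ π.parts, i ∈ V ∧ j ∈ V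

open Classical in
/-- The set `NC(n)` of all non-crossing partitions of an ordered set with `n` elements. -/
def NC (n : ℕ) : Finset (Finpartition (Finset.univ : Finset (Fin n))) :=
  Finset.univ.filter fun π => NonCrossingRel (SameBlock π)

/-- `i` and `j` are equivalent if, for `i ≤ j`, the interval `{i + 1, …, j}` is a union of
blocks of `π`. -/
def krewerasSetoid {n : ℕ} (π : Finpartition (Finset.univ : Finset (Fin n))) :
    Setoid (Fin n) where
  r i j := ∀ a b : Fin n, SameBlock π a b →
    (a ∈ Finset.Ioc (min i j) (max i j) ↔ b ∈ Finset.Ioc (min i j) (max i j))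
  iseqv := by
    refine ⟨fun i a b _ => by simp, fun {i j} h a b hab => ?_, fun {i j k} h₁ h₂ a b hab => ?_⟩
    · rw [min_comm, max_comm]
      exact h a b hab
    · have e₁ := h₁ a b hab
      have e₂ := h₂ a b hab
      simp only [Finset.mem_Ioc] at *
      grind

open Classical in
/-- The Kreweras complement `K(π)`: the largest partition of the copies `0', …, (n - 1)'` whose
union with `π` is non-crossing for the order `0 < 0' < 1 < 1' < ⋯ < n - 1 < (n - 1)'`
(see `interleave_kreweras` and `le_kreweras`). -/
def kreweras {n : ℕ} (π : Finpartition (Finset.univ : Finset (Fin n))) :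
    Finpartition (Finset.univ : Finset (Fin n)) :=
  Finpartition.ofSetoid (krewerasSetoid π)

/-- The union of a partition `π` of `{0, …, n - 1}` and a partition `σ` of `{0', …, (n - 1)'}`,
as an equivalence relation on `0 < 0' < 1 < 1' < ⋯`; here `(i, false)` stands for `i` and
`(i, true)` for `i'`. -/
def Interleave {n : ℕ} (π σ : Finpartition (Finset.univ : Finset (Fin n)))
    (p q : Fin n ×ₗ Bool) : Prop :=
  ((ofLex p).2 = false ∧ (ofLex q).2 = false ∧ SameBlock π (ofLex p).1 (ofLex q).1) ∨
  ((ofLex p).2 = true ∧ (ofLex q).2 = true ∧ SameBlock σ (ofLex p).1 (ofLex q).1)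

theorem sameBlock_kreweras {n : ℕ} (π : Finpartition (Finset.univ : Finset (Fin n)))
    (i j : Fin n) : SameBlock (kreweras π) i j ↔ krewerasSetoid π i j := by
  classical
  have h : j ∈ (kreweras π).part i ↔ krewerasSetoid π i j :=
    Finpartition.mem_part_ofSetoid_iff_rel
  rw [← h]
  constructor
  · rintro ⟨V, hV, hi, hj⟩
    rwa [Finpartition.part_eq_of_mem _ hV hi]
  · intro hj
    exact ⟨_, Finpartition.part_mem _ |>.2 (Finset.mem_univ i),
      Finpartition.mem_part _ (Finset.mem_univ i), hj⟩

theorem interleave_lt_iff {n : ℕ} (p q : Fin n ×ₗ Bool) :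
    p < q ↔ (ofLex p).1 < (ofLex q).1 ∨
      (ofLex p).1 = (ofLex q).1 ∧ (ofLex p).2 = false ∧ (ofLex q).2 = true := by
  rw [Prod.Lex.lt_iff, Bool.lt_iff]

theorem interleave_kreweras {n : ℕ} (π : Finpartition (Finset.univ : Finset (Fin n)))
    (hπ : π ∈ NC n) : NonCrossingRel (Interleave π (kreweras π)) := by
  classical
  have hnc : NonCrossingRel (SameBlock π) := by
    unfold NC at hπ
    exact (Finset.mem_filter.1 hπ).2
  intro p q r t hpq hqr hrt h₁ h₂
  rw [interleave_lt_iff] at hpq hqr hrt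
  rcases h₁ with ⟨hp, hr, h₁⟩ | ⟨hp, hr, h₁⟩ <;> rcases h₂ with ⟨hq, ht, h₂⟩ | ⟨hq, ht, h₂⟩ <;>
    simp only [hp, hq, hr, ht, Bool.false_eq_true, Bool.true_eq_false, and_false,
      or_false, and_true] at hpq hqr hrt
  · exact Or.inl ⟨hp, hq, hnc _ _ _ _ hpq hqr hrt h₁ h₂⟩
  · exfalso
    have e := ((sameBlock_kreweras π _ _).1 h₂) _ _ h₁
    simp only [Finset.mem_Ioc] at e
    grind
  · exfalso
    have e := ((sameBlock_kreweras π _ _).1 h₁) _ _ h₂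
    simp only [Finset.mem_Ioc] at e
    grind
  · refine Or.inr ⟨hp, hq, (sameBlock_kreweras π _ _).2 fun a b hab => ?_⟩
    have e₁ := ((sameBlock_kreweras π _ _).1 h₁) a b hab
    have e₂ := ((sameBlock_kreweras π _ _).1 h₂) a b hab
    simp only [Finset.mem_Ioc] at *
    grind

theorem le_kreweras {n : ℕ} (π σ : Finpartition (Finset.univ : Finset (Fin n)))
    (h : NonCrossingRel (Interleave π σ)) : σ ≤ kreweras π := by
  classical
  have key : ∀ i j a b : Fin n, SameBlock σ i j → i < j → SameBlock π a b →
      a ∈ Finset.Ioc i j → b ∈ Finset.Ioc i j := by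
    intro i j a b hij hlt hab ha
    rw [Finset.mem_Ioc] at ha
    by_contra hb
    rw [Finset.mem_Ioc, not_and_or, not_lt, not_le] at hb
    rcases hb with hb | hb
    · have := h (toLex (b, false)) (toLex (i, true)) (toLex (a, false)) (toLex (j, true))
        (by rw [interleave_lt_iff]; simpa using hb.lt_or_eq)
        (by rw [interleave_lt_iff]; simpa using ha.1)
        (by rw [interleave_lt_iff]; simpa using ha.2.lt_or_eq)
        (Or.inl ⟨rfl, rfl, by obtain ⟨V, hV, x, y⟩ := hab; exact ⟨V, hV, y, x⟩⟩)
        (Or.inr ⟨rfl, rfl, hij⟩)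
      simp [Interleave] at this
    · have := h (toLex (i, true)) (toLex (a, false)) (toLex (j, true)) (toLex (b, false))
        (by rw [interleave_lt_iff]; simpa using ha.1)
        (by rw [interleave_lt_iff]; simpa using ha.2.lt_or_eq)
        (by rw [interleave_lt_iff]; simpa using hb)
        (Or.inr ⟨rfl, rfl, hij⟩) (Or.inl ⟨rfl, rfl, hab⟩)
      simp [Interleave] at this
  have symm : ∀ a b : Fin n, SameBlock π a b → SameBlock π b a :=
    fun a b ⟨V, hV, x, y⟩ => ⟨V, hV, y, x⟩
  have key' : ∀ i j : Fin n, SameBlock σ i j → krewerasSetoid π i j := by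
    intro i j hij a b hab
    rcases lt_trichotomy i j with hlt | rfl | hlt
    · rw [min_eq_left hlt.le, max_eq_right hlt.le]
      exact ⟨key i j a b hij hlt hab, key i j b a hij hlt (symm a b hab)⟩
    · simp
    · rw [min_eq_right hlt.le, max_eq_left hlt.le]
      have hji : SameBlock σ j i := by obtain ⟨V, hV, x, y⟩ := hij; exact ⟨V, hV, y, x⟩
      exact ⟨key j i a b hji hlt hab, key j i b a hji hlt (symm a b hab)⟩
  intro V hV
  obtain ⟨i, hi⟩ := σ.nonempty_of_mem_parts hV
  refine ⟨(kreweras π).part i, (Finpartition.part_mem _).2 (Finset.mem_univ i), fun j hj => ?_⟩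
  exact Finpartition.mem_part_ofSetoid_iff_rel.2 (key' i j ⟨V, hV, hi, hj⟩)

/-! ### Boxed convolution -/

/-- The restriction `w|V` of a word `w` to a nonempty set `V` of positions. -/
def restrict {s : ℕ} (w : Word s) (V : Finset (Fin w.1.length)) (hV : V.Nonempty) : Word s :=
  ⟨(V.sort (· ≤ ·)).map w.1.get, by
    obtain ⟨i, hi⟩ := hV
    intro h
    have hm : i ∈ V.sort (· ≤ ·) := (Finset.mem_sort _).2 hi
    rw [List.map_eq_nil_iff.1 h] at hm
    exact List.not_mem_nil hm⟩

/-- The product of the coefficients of `f` at the words `w|V`, over all blocks `V` of `π`. -/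
def blockCoeff {s : ℕ} {R : Type*} [CommRing R] (f : Series s R) (w : Word s)
    (π : Finpartition (Finset.univ : Finset (Fin w.1.length))) : R :=
  ∏ V ∈ π.parts.attach, f (restrict w V.1 (π.nonempty_of_mem_parts V.2))

/-- The boxed convolution of power series without constant term. -/
def boxConv {s : ℕ} {R : Type*} [CommRing R] (f g : Series s R) : Series s R :=
  fun w => ∑ π ∈ NC w.1.length, blockCoeff f w π * blockCoeff g w (kreweras π)

/-- The series `x₁ + ⋯ + x_s`, neutral for boxed convolution. -/
def boxOne (s : ℕ) (R : Type*) [CommRing R] : Series s R :=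
  fun w => if w.1.length = 1 then 1 else 0

/-- The series `Zeta`, all of whose coefficients are `1`. -/
def zeta (s : ℕ) (R : Type*) [CommRing R] : Series s R := fun _ => 1

/-- `g` is a (two-sided) inverse of `f` for boxed convolution. -/
def IsBoxInverse {s : ℕ} {R : Type*} [CommRing R] (f g : Series s R) : Prop :=
  boxConv f g = boxOne s R ∧ boxConv g f = boxOne s R

/-! ### The free product of linear functionals -/

section FreeProduct

variable {R A B : Type*} [CommRing R] [Ring A] [Ring B] [Algebra R A] [Algebra R B]

/-- Multiply consecutive elements of the same algebra in a product of elements of `A` and `B`;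
the result is alternating and represents the same element of the free product of `A` and `B`. -/
def contract : List (A ⊕ B) → List (A ⊕ B)
  | [] => []
  | Sum.inl a :: l =>
    match contract l with
    | Sum.inl a' :: l' => Sum.inl (a * a') :: l'
    | l' => Sum.inl a :: l'
  | Sum.inr b :: l =>
    match contract l with
    | Sum.inr b' :: l' => Sum.inr (b * b') :: l'
    | l' => Sum.inr b :: l'

theorem length_contract_le (l : List (A ⊕ B)) : (contract l).length ≤ l.length := by
  induction l with
  | nil => simp [contract]
  | cons c l ih => cases c <;> simp only [contract] <;> split <;> simp_all <;> omega

/-- The sublist of `l` at the set of positions `I`, in the original order. -/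
def sublistAt {C : Type*} (l : List C) (I : Finset (Fin l.length)) : List C :=
  (I.sort (· ≤ ·)).map l.get

/-- The value of the free product of the functionals `f` on `A` and `g` on `B` at a product of
elements of `A` and `B`. For an alternating product `a₁ ⋯ aₘ` with `m ≥ 1` it is
`∑_{I ⊊ {1, …, m}} (-1)^(m - |I| + 1) (value at ∏_{i ∈ I} aᵢ) ∏_{i ∉ I} φᵢ(aᵢ)`,
with `φᵢ = f` if `aᵢ ∈ A` and `φᵢ = g` if `aᵢ ∈ B`, and it is `1` at the empty product. -/
def freeValue (f : A →ₗ[R] R) (g : B →ₗ[R] R) (l : List (A ⊕ B)) : R :=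
  if contract l = [] then 1 else
    ∑ I : {I : Finset (Fin (contract l).length) // I ⊂ Finset.univ},
      (-1) ^ ((contract l).length - I.1.card + 1) *
        freeValue f g (sublistAt (contract l) I.1) *
        ∏ i ∈ I.1ᶜ, Sum.elim f g ((contract l).get i)
termination_by l.length
decreasing_by
  have h₁ := Finset.card_lt_card I.2
  have h₂ := length_contract_le l
  simp only [Finset.card_univ, Fintype.card_fin] at h₁
  simp only [sublistAt, List.length_map, Finset.length_sort]
  omega

end FreeProduct

/-- The free product `f •_F g` of two linear functionals on `R⟨x₁, …, x_s⟩`, as a linear functional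
on the coproduct of unital algebras `R⟨x₁, …, x_s⟩ ⨿ R⟨x₁, …, x_s⟩ = R⟨x₁, …, x_s, y₁, …, y_s⟩`
(`Sum.inl i` stands for `xᵢ` and `Sum.inr i` for `yᵢ`), by linear extension from the words. -/
def freeProduct {s : ℕ} {R : Type*} [CommRing R] (f g : FreeAlgebra R (Fin s) →ₗ[R] R) :
    FreeAlgebra R (Fin s ⊕ Fin s) →ₗ[R] R :=
  (FreeAlgebra.basisFreeMonoid R (Fin s ⊕ Fin s)).constr R fun u =>
    freeValue f g ((FreeMonoid.toList u).map (Sum.map (FreeAlgebra.ι R) (FreeAlgebra.ι R)))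

/-- The coproduct `Δ_m`, the homomorphism of unital algebras with `xᵢ ↦ xᵢ yᵢ`. -/
def comulM (s : ℕ) (R : Type*) [CommRing R] :
    FreeAlgebra R (Fin s) →ₐ[R] FreeAlgebra R (Fin s ⊕ Fin s) :=
  FreeAlgebra.lift R fun i => FreeAlgebra.ι R (Sum.inl i) * FreeAlgebra.ι R (Sum.inr i)

/-- The unital linear functional on `R⟨x₁, …, x_s⟩` whose value at the monomial of a nonempty
word `w` is the coefficient of `f` at `w`. -/
def functional {s : ℕ} {R : Type*} [CommRing R] (f : Series s R) :
    FreeAlgebra R (Fin s) →ₗ[R] R :=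
  (FreeAlgebra.basisFreeMonoid R (Fin s)).constr R fun u =>
    if h : FreeMonoid.toList u = [] then 1 else f ⟨FreeMonoid.toList u, h⟩

end FreeConv

end

open FreeConv

set_option linter.unusedSectionVars false

/-! ### Power series in non-commuting variables -/

/-! Put `κ = f ⊠ Moeb`. Since `κ ⊠ Zeta = f`, these are the free cumulants of `f`. If the `x`-family
has cumulants `κ` and is free from a `y`-family with moments `g`, a joint moment is a sum over
non-crossing partitions of the `x`-positions: each block contributes a coefficient of `κ`, and the
`y`-letters in each region left by the partition contribute a moment of `g`. On `x₁y₁x₂y₂⋯` the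
regions are the blocks of the Kreweras complement, so the sum is `κ ⊠ g`. The proof makes this
precise with series in non-commuting variables that are characterised by functional equations; all
such equations are contractions for the degree, hence have unique solutions.

Boxed convolution. A series with constant term `1` stands for a series without one. Following the
first block of `π`, or the last block of its complement, gives `f ⊠ g = f(β) = g(γ)` with `βᵢ = xᵢ
(∂ᵢg)(γ)` and `γᵢ = (f∂ᵢ)(β) xᵢ`, where `∂ᵢ` on the left or right removes a first or last letter
`i`. For a triple product both bracketings have the form `f(β)`, with `β` the first component of one
and the same system of three equations (`triple_system_unique`); this is associativity. For `Zeta`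
the system collapses: `H = f ⊠ Zeta` is the only solution of `H = f(xᵢH)`, and `Zeta ⊠ f` the only
solution of `H = f(Hxᵢ)`. An explicit Catalan-type series solves both with `H = 1 + ∑ xᵢ`
(`exists_moebius`), which gives the Möbius series; associativity makes it unique.

Free product. `freeMoment` is the series of joint moments, given by reading words letter by letter.
Its centered alternating products vanish (`centered_freeMoment`), and expanding such a product over
subsets of its factors is exactly the recursion that defines the free product
(`freeValue_eq_of_centered`). Its restrictions are `κ ⊠ Zeta = f` and `g`, and along doubled words
it satisfies the recursion of `κ ⊠ g` (`alongDouble_freeMoment`).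

Partitions enter only in `boxConv_eq_box`: the sum over `NC(n)` obeys the recursion `ncRec`, by
splitting at the position that follows the first one in its block. -/

/-- Power series over `R` in non-commuting variables indexed by `α`. -/
def NCSeries (α R : Type*) : Type _ := List α → R

namespace NCSeries

variable {α β γ R : Type*} [CommRing R]

@[ext] theorem ext {F G : NCSeries α R} (h : ∀ w, F w = G w) : F = G := funext h

instance : AddCommGroup (NCSeries α R) := inferInstanceAs (AddCommGroup (List α → R))

@[simp] theorem zero_apply (w : List α) : (0 : NCSeries α R) w = 0 := rfl
@[simp] theorem add_apply (F G : NCSeries α R) (w : List α) : (F + G) w = F w + G w := rfl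
@[simp] theorem neg_apply (F : NCSeries α R) (w : List α) : (-F) w = -F w := rfl
@[simp] theorem sub_apply (F G : NCSeries α R) (w : List α) : (F - G) w = F w - G w := rfl

theorem sum_apply {ι : Type*} (t : Finset ι) (F : ι → NCSeries α R) (w : List α) :
    (∑ i ∈ t, F i) w = ∑ i ∈ t, F i w := Finset.sum_apply w t F

/-- Cauchy product, by recursion on the word. -/
def mul : NCSeries α R → NCSeries α R → List α → R
  | F, G, [] => F [] * G []
  | F, G, i :: w => mul (fun u => F (i :: u)) G w + F [] * G (i :: w)

instance : Mul (NCSeries α R) := ⟨mul⟩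

/-- The constant series. -/
def C (r : R) : NCSeries α R
  | [] => r
  | _ :: _ => 0

instance : One (NCSeries α R) := ⟨C 1⟩

/-- The left derivative: the coefficients at the words that start with `i`. -/
def D (i : α) (F : NCSeries α R) : NCSeries α R := fun w => F (i :: w)

theorem cons_apply (F : NCSeries α R) (i : α) (w : List α) : F (i :: w) = D i F w := rfl
theorem D_apply (F : NCSeries α R) (i : α) (w : List α) : D i F w = F (i :: w) := rfl

@[simp] theorem C_nil (r : R) : (C r : NCSeries α R) [] = r := rfl
@[simp] theorem one_nil : (1 : NCSeries α R) [] = 1 := rfl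
@[simp] theorem mul_nil (F G : NCSeries α R) : (F * G) [] = F [] * G [] := rfl
@[simp] theorem D_C (i : α) (r : R) : D i (C r : NCSeries α R) = 0 := rfl
@[simp] theorem D_one (i : α) : D i (1 : NCSeries α R) = 0 := rfl
@[simp] theorem D_zero (i : α) : D i (0 : NCSeries α R) = 0 := rfl
@[simp] theorem D_add (i : α) (F G : NCSeries α R) : D i (F + G) = D i F + D i G := rfl
@[simp] theorem D_sub (i : α) (F G : NCSeries α R) : D i (F - G) = D i F - D i G := rfl
theorem C_one : (C 1 : NCSeries α R) = 1 := rfl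

theorem mul_cons (F G : NCSeries α R) (i : α) (w : List α) :
    (F * G) (i :: w) = (D i F * G) w + F [] * G (i :: w) := rfl

theorem ext_D {F G : NCSeries α R} (h0 : F [] = G []) (h : ∀ i, D i F = D i G) : F = G := by
  ext w
  cases w with
  | nil => exact h0
  | cons i w => exact congrFun (h i) w

protected theorem add_mul' (F G H : NCSeries α R) : (F + G) * H = F * H + G * H := by
  ext w
  induction w generalizing F G with
  | nil => simp [add_mul]
  | cons i w ih => simp only [mul_cons, D_add, ih, add_apply]; ring

protected theorem mul_add' (F G H : NCSeries α R) : F * (G + H) = F * G + F * H := by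
  ext w
  induction w generalizing F with
  | nil => simp [mul_add]
  | cons i w ih => simp only [mul_cons, ih, add_apply]; ring

protected theorem zero_mul' (F : NCSeries α R) : 0 * F = 0 := by
  ext w
  induction w with
  | nil => simp
  | cons i w ih => simp [mul_cons, ih]

protected theorem mul_zero' (F : NCSeries α R) : F * 0 = 0 := by
  ext w
  induction w generalizing F with
  | nil => simp
  | cons i w ih => simp [mul_cons, ih]

theorem C_mul_apply (r : R) (F : NCSeries α R) (w : List α) :
    (C r * F : NCSeries α R) w = r * F w := by
  cases w with
  | nil => rfl
  | cons i w => rw [mul_cons, D_C, NCSeries.zero_mul']; simp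

theorem D_mul (i : α) (F G : NCSeries α R) : D i (F * G) = D i F * G + C (F []) * D i G := by
  ext w
  rw [D_apply, mul_cons, add_apply, C_mul_apply, D_apply]

theorem C_mul_mul (r : R) (F G : NCSeries α R) : C r * F * G = C r * (F * G) := by
  ext w
  induction w generalizing F with
  | nil => simp [mul_assoc]
  | cons i w ih =>
    rw [mul_cons, D_mul, D_C, NCSeries.zero_mul', zero_add, C_nil, ih, C_mul_apply, C_mul_apply,
      C_mul_apply, mul_cons]
    ring

protected theorem mul_assoc' (F G H : NCSeries α R) : F * G * H = F * (G * H) := by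
  ext w
  induction w generalizing F G H with
  | nil => simp [mul_assoc]
  | cons i w ih =>
    rw [mul_cons, D_mul, NCSeries.add_mul', add_apply, ih, C_mul_mul, C_mul_apply, mul_cons,
      mul_cons, mul_nil]
    ring

instance : Ring (NCSeries α R) :=
  { (inferInstance : AddCommGroup (NCSeries α R)) with
    mul := (· * ·)
    one := 1
    left_distrib := NCSeries.mul_add'
    right_distrib := NCSeries.add_mul'
    zero_mul := NCSeries.zero_mul'
    mul_zero := NCSeries.mul_zero'
    mul_assoc := NCSeries.mul_assoc'
    one_mul := fun F => by ext w; rw [← C_one, C_mul_apply, one_mul]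
    mul_one := fun F => by
      ext w
      induction w generalizing F with
      | nil => simp
      | cons i w ih => rw [mul_cons, ih, cons_apply 1, D_one]; simp [D_apply] }

theorem D_sum {ι : Type*} (t : Finset ι) (F : ι → NCSeries α R) (i : α) :
    D i (∑ j ∈ t, F j) = ∑ j ∈ t, D i (F j) := by
  ext w; simp only [D_apply, sum_apply]

theorem C_mul (r s : R) : (C (r * s) : NCSeries α R) = C r * C s := by
  ext w
  rw [C_mul_apply]
  cases w <;> simp [C]

theorem C_add (r s : R) : (C (r + s) : NCSeries α R) = C r + C s := by
  ext w
  cases w <;> simp [C]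

theorem C_zero : (C 0 : NCSeries α R) = 0 := by
  ext w
  cases w <;> simp [C]

theorem mul_C (F : NCSeries α R) (r : R) : F * C r = C r * F := by
  ext w
  rw [C_mul_apply]
  induction w generalizing F with
  | nil => simp [mul_comm]
  | cons i w ih => rw [mul_cons, ih, cons_apply (C r), D_C]; simp [D_apply]

theorem mul_apply (F G : NCSeries α R) (w : List α) :
    (F * G) w = ∑ k ∈ Finset.range (w.length + 1), F (w.take k) * G (w.drop k) := by
  induction w generalizing F with
  | nil => simp
  | cons i w ih =>
    rw [mul_cons, ih, List.length_cons, Finset.sum_range_succ' _ (w.length + 1)]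
    simp [D_apply]

/-- The right derivative: the coefficients at the words that end with `i`. -/
def RD (i : α) (F : NCSeries α R) : NCSeries α R := fun w => F (w ++ [i])

theorem RD_apply (F : NCSeries α R) (i : α) (w : List α) : RD i F w = F (w ++ [i]) := rfl

theorem D_RD (i j : α) (F : NCSeries α R) : D i (RD j F) = RD j (D i F) := rfl

section X
variable [DecidableEq α]

/-- The variable `i`. -/
def X (i : α) : NCSeries α R := fun w => if w = [i] then 1 else 0

@[simp] theorem X_nil (i : α) : (X i : NCSeries α R) [] = 0 := by simp [X]

theorem D_X (i j : α) : D i (X j : NCSeries α R) = if i = j then 1 else 0 := by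
  ext w
  by_cases h : i = j
  · subst h
    cases w with
    | nil => simp [X, D_apply]
    | cons j w => rw [if_pos rfl, cons_apply 1, D_one]; simp [X, D_apply]
  · simp [X, D_apply, h]

theorem X_mul_nil (i : α) (F : NCSeries α R) : (X i * F : NCSeries α R) [] = 0 := by simp

theorem mul_X_nil (i : α) (F : NCSeries α R) : (F * X i : NCSeries α R) [] = 0 := by simp

theorem D_X_mul (i j : α) (F : NCSeries α R) : D i (X j * F) = if i = j then F else 0 := by
  rw [D_mul, D_X, X_nil, C_zero, zero_mul, add_zero]
  split_ifs <;> simp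

theorem D_sum_X_mul [Fintype α] (i : α) (F : α → NCSeries α R) :
    D i (∑ j, X j * F j) = F i := by
  simp [D_sum, D_X_mul]

theorem sum_X_mul_nil [Fintype α] (F : α → NCSeries α R) :
    (∑ j, X j * F j : NCSeries α R) [] = 0 := by
  simp [sum_apply]

theorem eq_C_add_sum [Fintype α] (F : NCSeries α R) : F = C (F []) + ∑ i, X i * D i F := by
  refine ext_D (by simp [sum_apply]) fun i => ?_
  rw [D_add, D_C, D_sum_X_mul, zero_add]

theorem RD_mul_X (i j : α) (F : NCSeries α R) : RD i (F * X j) = if i = j then F else 0 := by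
  ext w
  rw [RD_apply]
  induction w generalizing F with
  | nil =>
    rw [List.nil_append, mul_cons]
    split_ifs <;> simp_all [X]
  | cons k w ih =>
    rw [List.cons_append, mul_cons, ih]
    split_ifs <;> simp [X, D_apply]

theorem RD_sum_mul_X [Fintype α] (i : α) (F : α → NCSeries α R) :
    RD i (∑ j, F j * X j) = F i := by
  have : RD i (∑ j, F j * X j) = ∑ j, RD i (F j * X j) := by
    ext w; simp only [RD_apply, sum_apply]
  simp [this, RD_mul_X]

end X

/-! ### Contractions -/

/-- Two series agree at the words of length less than `n`. -/
def Agree (n : ℕ) (F G : NCSeries α R) : Prop := ∀ w : List α, w.length < n → F w = G w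

theorem Agree.refl (n : ℕ) (F : NCSeries α R) : Agree n F F := fun _ _ => rfl
theorem Agree.symm {n : ℕ} {F G : NCSeries α R} (h : Agree n F G) : Agree n G F :=
  fun w hw => (h w hw).symm
theorem Agree.trans {n : ℕ} {F G H : NCSeries α R} (h : Agree n F G) (h' : Agree n G H) :
    Agree n F H := fun w hw => (h w hw).trans (h' w hw)
theorem Agree.mono {m n : ℕ} {F G : NCSeries α R} (h : Agree n F G) (hmn : m ≤ n) :
    Agree m F G := fun w hw => h w (hw.trans_le hmn)
theorem Agree.zero (F G : NCSeries α R) : Agree 0 F G := fun _ hw => absurd hw (Nat.not_lt_zero _)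
theorem Agree.add {n : ℕ} {F G F' G' : NCSeries α R} (h : Agree n F F') (h' : Agree n G G') :
    Agree n (F + G) (F' + G') := fun w hw => by simp [h w hw, h' w hw]
theorem Agree.sub {n : ℕ} {F G F' G' : NCSeries α R} (h : Agree n F F') (h' : Agree n G G') :
    Agree n (F - G) (F' - G') := fun w hw => by simp [h w hw, h' w hw]
theorem Agree.sum {ι : Type*} {n : ℕ} {t : Finset ι} {F G : ι → NCSeries α R}
    (h : ∀ i, Agree n (F i) (G i)) : Agree n (∑ i ∈ t, F i) (∑ i ∈ t, G i) := fun w hw => by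
  rw [sum_apply, sum_apply]; exact Finset.sum_congr rfl fun i _ => h i w hw

theorem Agree.mul {n : ℕ} {F G F' G' : NCSeries α R} (h : Agree n F F') (h' : Agree n G G') :
    Agree n (F * G) (F' * G') := fun w hw => by
  rw [mul_apply, mul_apply]
  refine Finset.sum_congr rfl fun k _ => ?_
  rw [h _ (by simp; omega), h' _ (by simp; omega)]

/-- A left factor without constant term uses up at least one letter, so the right factor is only
read on shorter words. This is the source of every gain of a degree below. -/
theorem Agree.mul_left_succ {n : ℕ} {F F' G G' : NCSeries α R} (hF' : F' [] = 0)
    (h : Agree (n + 1) F F') (h' : Agree n G G') : Agree (n + 1) (F * G) (F' * G') :=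
  fun w hw => by
  rw [mul_apply, mul_apply]
  refine Finset.sum_congr rfl fun k _ => ?_
  rw [h _ (by simp; omega)]
  rcases w with _ | ⟨i, w⟩
  · simp [hF']
  rcases k with _ | k
  · simp [hF']
  rw [h' _ (by simp at hw ⊢; omega)]

theorem Agree.mul_right_succ {n : ℕ} {F F' G G' : NCSeries α R} (hG' : G' [] = 0)
    (h : Agree n F F') (h' : Agree (n + 1) G G') : Agree (n + 1) (F * G) (F' * G') :=
  fun w hw => by
  rw [mul_apply, mul_apply]
  refine Finset.sum_congr rfl fun k hk => ?_
  rw [h' _ (by simp; omega)]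
  by_cases hkw : k < w.length
  · rw [h _ (by simp; omega)]
  · rw [List.drop_eq_nil_of_le (by omega), hG', mul_zero, mul_zero]

theorem Agree.X_mul [DecidableEq α] {n : ℕ} {G G' : NCSeries α R} (i : α) (h : Agree n G G') :
    Agree (n + 1) (X i * G) (X i * G') :=
  Agree.mul_left_succ (X_nil i) (Agree.refl _ _) h

theorem Agree.mul_X [DecidableEq α] {n : ℕ} {G G' : NCSeries α R} (i : α) (h : Agree n G G') :
    Agree (n + 1) (G * X i) (G' * X i) :=
  Agree.mul_right_succ (X_nil i) h (Agree.refl _ _)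

theorem eq_of_agree {F G : NCSeries α R} (h : ∀ n, Agree n F G) : F = G :=
  ext fun w => h (w.length + 1) w (Nat.lt_succ_self _)

/-- A self-map of a family of series gaining one degree of precision. -/
def Contraction {ι : Type*} (Φ : (ι → NCSeries α R) → ι → NCSeries α R) : Prop :=
  ∀ n P Q, (∀ x, Agree n (P x) (Q x)) → ∀ x, Agree (n + 1) (Φ P x) (Φ Q x)

theorem Contraction.unique {ι : Type*} {Φ : (ι → NCSeries α R) → ι → NCSeries α R}
    (h : Contraction Φ) {P Q : ι → NCSeries α R} (hP : P = Φ P) (hQ : Q = Φ Q) : P = Q := by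
  have key : ∀ n, ∀ x, Agree n (P x) (Q x) := by
    intro n
    induction n with
    | zero => exact fun x => Agree.zero _ _
    | succ n ih => intro x; rw [hP, hQ]; exact h n P Q ih x
  exact funext fun x => eq_of_agree fun n => key n x

/-- The iterates starting from zero stabilise in each degree; the solution is read off along the
diagonal. -/
theorem Contraction.exists {ι : Type*} {Φ : (ι → NCSeries α R) → ι → NCSeries α R}
    (h : Contraction Φ) : ∃ P : ι → NCSeries α R, P = Φ P := by
  let P : ℕ → ι → NCSeries α R := fun n => Φ^[n] fun _ => 0
  have hs : ∀ n, P (n + 1) = Φ (P n) := fun n => Function.iterate_succ_apply' Φ n _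
  have h1 : ∀ n, ∀ x, Agree n (P n x) (P (n + 1) x) := by
    intro n
    induction n with
    | zero => exact fun x => Agree.zero _ _
    | succ n ih => intro x; rw [hs n, hs (n + 1)]; exact h n _ _ ih x
  have h2 : ∀ n k, ∀ x, Agree n (P n x) (P (n + k) x) := by
    intro n k
    induction k with
    | zero => exact fun x => Agree.refl _ _
    | succ k ih => exact fun x => (ih x).trans ((h1 (n + k) x).mono (by omega))
  -- The coefficient at `w` no longer changes from iterate `w.length + 1` on.
  let L : ι → NCSeries α R := fun x w => P (w.length + 1) x w
  have h3 : ∀ n, ∀ x, Agree n (L x) (P n x) := by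
    intro n x w hw
    obtain ⟨k, rfl⟩ := Nat.exists_eq_add_of_lt hw
    have := h2 (w.length + 1) k x w (Nat.lt_succ_self _)
    rw [show w.length + k + 1 = w.length + 1 + k by omega]
    exact this
  refine ⟨L, funext fun x => eq_of_agree fun n => ?_⟩
  have h4 : Agree (n + 1) (Φ L x) (P (n + 1) x) := by rw [hs]; exact h n _ _ (h3 n) x
  exact ((h3 (n + 1) x).trans h4.symm).mono (Nat.le_succ n)

/-! ### Substitution -/

section Subst
variable [Fintype α]

theorem contraction_subst (Y : α → NCSeries β R) (hY : ∀ i, Y i [] = 0) :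
    Contraction fun (P : NCSeries α R → NCSeries β R) F => C (F []) + ∑ i, Y i * P (D i F) :=
  fun _ _ _ h _ => (Agree.refl _ _).add <| Agree.sum fun i =>
    Agree.mul_left_succ (hY i) (Agree.refl _ _) (h _)

/-- Zero solves the same homogeneous contraction. Identities about substitution are proved by
feeding the difference of the two sides to this lemma; `nxt` records how the parameters change when
a letter is read. -/
theorem eq_zero_of_eq_sum {ι : Type*} {Y : α → NCSeries β R} (hY : ∀ i, Y i [] = 0)
    (nxt : α → ι → ι) {P : ι → NCSeries β R} (hP : ∀ x, P x = ∑ i, Y i * P (nxt i x)) (x : ι) :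
    P x = 0 := by
  have hc : Contraction fun (P : ι → NCSeries β R) x => ∑ i, Y i * P (nxt i x) :=
    fun _ _ _ h _ => Agree.sum fun i => Agree.mul_left_succ (hY i) (Agree.refl _ _) (h _)
  exact congrFun (hc.unique (Q := fun _ => 0) (funext hP) (by simp)) x

/-- Substitution of series without constant term for the variables; constant terms of the
substituted series are discarded. -/
noncomputable def subst (Y : α → NCSeries β R) : NCSeries α R → NCSeries β R :=
  (contraction_subst (fun i => Y i - C (Y i [])) fun i => by simp).exists.choose

variable {Y : α → NCSeries β R}

theorem subst_eq (hY : ∀ i, Y i [] = 0) (F : NCSeries α R) :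
    subst Y F = C (F []) + ∑ i, Y i * subst Y (D i F) := by
  have h2 := congrFun
    (contraction_subst (fun i => Y i - C (Y i [])) fun i => by simp).exists.choose_spec F
  have h3 : subst Y F = C (F []) + ∑ i, (Y i - C (Y i [])) * subst Y (D i F) := h2
  simpa only [hY, C_zero, sub_zero] using h3

/-- The defining equation of a substitution relates a series to its left derivatives only, so it is
enough to know it on a family closed under them. -/
theorem eq_subst_of_family {ι : Type*} (hY : ∀ i, Y i [] = 0) (nxt : α → ι → ι)
    {P : ι → NCSeries β R} {F : ι → NCSeries α R} (hF : ∀ i x, D i (F x) = F (nxt i x))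
    (hP : ∀ x, P x = C (F x []) + ∑ i, Y i * P (nxt i x)) (x : ι) : P x = subst Y (F x) := by
  refine sub_eq_zero.1 (eq_zero_of_eq_sum (P := fun x => P x - subst Y (F x)) hY nxt ?_ x)
  intro x
  conv_lhs => rw [hP, subst_eq hY]
  simp only [hF, mul_sub, Finset.sum_sub_distrib]
  abel

theorem eq_subst (hY : ∀ i, Y i [] = 0) {P : NCSeries α R → NCSeries β R}
    (hP : ∀ F, P F = C (F []) + ∑ i, Y i * P (D i F)) (F : NCSeries α R) : P F = subst Y F :=
  eq_subst_of_family (F := id) hY D (fun _ _ => rfl) hP F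

theorem subst_nil (hY : ∀ i, Y i [] = 0) (F : NCSeries α R) : subst Y F [] = F [] := by
  rw [subst_eq hY]; simp [sum_apply, hY]

theorem subst_zero (hY : ∀ i, Y i [] = 0) : subst Y (0 : NCSeries α R) = 0 :=
  (eq_subst_of_family (ι := Unit) (P := fun _ => 0) (F := fun _ => 0) hY (fun _ _ => ())
    (fun _ _ => rfl) (fun _ => by simp [C_zero]) ()).symm

theorem subst_C (hY : ∀ i, Y i [] = 0) (r : R) : subst Y (C r) = C r := by
  rw [subst_eq hY]; simp [subst_zero hY]

theorem subst_one (hY : ∀ i, Y i [] = 0) : subst Y (1 : NCSeries α R) = 1 := subst_C hY 1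

theorem subst_add (hY : ∀ i, Y i [] = 0) (F G : NCSeries α R) :
    subst Y (F + G) = subst Y F + subst Y G := by
  refine (eq_subst_of_family (ι := NCSeries α R × NCSeries α R)
    (P := fun x => subst Y x.1 + subst Y x.2) (F := fun x => x.1 + x.2) hY
    (fun i x => (D i x.1, D i x.2)) (fun _ _ => rfl) (fun x => ?_) (F, G)).symm
  simp only [mul_add, Finset.sum_add_distrib]
  conv_lhs => rw [subst_eq hY x.1, subst_eq hY x.2]
  rw [add_apply, C_add]
  abel

theorem subst_C_mul (hY : ∀ i, Y i [] = 0) (r : R) (F : NCSeries α R) :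
    subst Y (C r * F) = C r * subst Y F := by
  refine (eq_subst_of_family (P := fun F => C r * subst Y F) (F := fun F => C r * F) hY
    D (fun i F => ?_) (fun F => ?_) F).symm
  · rw [D_mul]; simp
  · conv_lhs => rw [subst_eq hY F]
    rw [mul_add, Finset.mul_sum, mul_nil, C_mul, C_nil]
    congr 1
    exact Finset.sum_congr rfl fun i _ => by rw [← mul_assoc, ← mul_C, mul_assoc]

/-- For fixed `G` the defect of multiplicativity, as a function of `F`, satisfies the homogeneous
equation, because left derivatives obey a twisted Leibniz rule. -/
theorem subst_mul (hY : ∀ i, Y i [] = 0) (F G : NCSeries α R) :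
    subst Y (F * G) = subst Y F * subst Y G := by
  refine sub_eq_zero.1 (eq_zero_of_eq_sum
    (P := fun F => subst Y (F * G) - subst Y F * subst Y G) hY D (fun F => ?_) F)
  have h1 : subst Y (F * G)
      = C (F []) * subst Y G + ∑ i, Y i * subst Y (D i F * G) := by
    rw [subst_eq hY (F * G)]
    conv_rhs => rw [subst_eq hY G]
    simp only [D_mul, subst_add hY, subst_C_mul hY, mul_add, Finset.sum_add_distrib, mul_nil,
      C_mul, Finset.mul_sum]
    rw [Finset.sum_congr rfl fun i _ => show Y i * (C (F []) * subst Y (D i G))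
      = C (F []) * (Y i * subst Y (D i G)) by rw [← mul_assoc, mul_C, mul_assoc]]
    abel
  conv_lhs => rw [h1, subst_eq hY F]
  simp only [mul_sub, Finset.sum_sub_distrib, add_mul, Finset.sum_mul, mul_assoc]
  abel

theorem subst_sum (hY : ∀ i, Y i [] = 0) {ι : Type*} (t : Finset ι) (F : ι → NCSeries α R) :
    subst Y (∑ i ∈ t, F i) = ∑ i ∈ t, subst Y (F i) := by
  classical
  induction t using Finset.induction_on with
  | empty => simp [subst_zero hY]
  | insert a t ha ih => rw [Finset.sum_insert ha, Finset.sum_insert ha, subst_add hY, ih]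

theorem subst_X [DecidableEq α] (hY : ∀ i, Y i [] = 0) (i : α) : subst Y (X i) = Y i := by
  rw [subst_eq hY, Finset.sum_eq_single i]
  · simp [D_X, C_zero, subst_one hY]
  · intro j _ hj; simp [D_X, hj, subst_zero hY]
  · simp

theorem subst_X_self [DecidableEq α] (F : NCSeries α R) : subst X F = F :=
  (eq_subst (P := fun F => F) X_nil eq_C_add_sum F).symm

theorem subst_subst [Fintype β] {Z : β → NCSeries γ R} (hY : ∀ i, Y i [] = 0)
    (hZ : ∀ i, Z i [] = 0) (F : NCSeries α R) :
    subst Z (subst Y F) = subst (fun i => subst Z (Y i)) F := by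
  refine eq_subst (P := fun F => subst Z (subst Y F)) (fun i => by rw [subst_nil hZ, hY])
    (fun F => ?_) F
  conv_lhs => rw [subst_eq hY, subst_add hZ, subst_sum hZ, subst_C hZ]
  simp only [subst_mul hZ]

/-- Substitution is defined by peeling off first letters; this is the mirror form, needed because
gaps in the Kreweras complement precede the letters of a block. -/
theorem subst_eq_right (hY : ∀ i, Y i [] = 0) (F : NCSeries α R) :
    subst Y F = C (F []) + ∑ i, subst Y (RD i F) * Y i := by
  refine (eq_subst (P := fun F => C (F []) + ∑ i, subst Y (RD i F) * Y i) hY (fun F => ?_) F).symm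
  simp only [mul_add, Finset.sum_add_distrib, Finset.mul_sum]
  congr 1
  rw [Finset.sum_comm, ← Finset.sum_add_distrib]
  refine Finset.sum_congr rfl fun j _ => ?_
  conv_lhs => rw [subst_eq hY (RD j F)]
  rw [add_mul, Finset.sum_mul, mul_C]
  simp only [D_RD, mul_assoc]
  rfl

/-- Used for `Yᵢ = G xᵢ` and `Y'ᵢ = xᵢ G`: in a product `G x G x ⋯ G` the bracketing may start at
either end. -/
theorem subst_mul_shift (G : NCSeries β R) {Y Y' : α → NCSeries β R} (hY : ∀ i, Y i [] = 0)
    (hY' : ∀ i, Y' i [] = 0) (h : ∀ i, Y i * G = G * Y' i) (F : NCSeries α R) :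
    subst Y F * G = G * subst Y' F := by
  refine sub_eq_zero.1 (eq_zero_of_eq_sum
    (P := fun F => subst Y F * G - G * subst Y' F) hY D (fun F => ?_) F)
  conv_lhs => rw [subst_eq hY F, subst_eq hY' F]
  simp only [add_mul, mul_add, Finset.sum_mul, Finset.mul_sum, mul_sub, Finset.sum_sub_distrib,
    mul_C, ← mul_assoc, h]
  abel

theorem subst_discard (Y : α → NCSeries β R) (F : NCSeries α R) :
    subst Y F = subst (fun i => Y i - C (Y i [])) F :=
  eq_subst (fun i => by simp)
    (fun F => congrFun
      (contraction_subst (fun i => Y i - C (Y i [])) fun i => by simp).exists.choose_spec F) F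

theorem Agree.subst {n : ℕ} {Y Y' : α → NCSeries β R} (h : ∀ i, Agree n (Y i) (Y' i))
    (F : NCSeries α R) : Agree n (NCSeries.subst Y F) (NCSeries.subst Y' F) := by
  have key : ∀ m ≤ n, ∀ F : NCSeries α R, Agree m (NCSeries.subst Y F) (NCSeries.subst Y' F) := by
    intro m
    induction m with
    | zero => exact fun _ F => Agree.zero _ _
    | succ m ih =>
      intro hm F
      have h0 : ∀ i, Y i [] = Y' i [] := fun i => h i [] (by simp; omega)
      rw [subst_discard Y, subst_discard Y', subst_eq (by simp), subst_eq (by simp)]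
      refine (Agree.refl _ _).add <| Agree.sum fun i => Agree.mul_left_succ (by simp) ?_ ?_
      · rw [h0]; exact ((h i).mono hm).sub (Agree.refl _ _)
      · rw [← subst_discard, ← subst_discard]; exact ih (by omega) _
  exact key n le_rfl F

end Subst

end NCSeries

/-! ### Boxed convolution by recursion on words, and its associativity -/

namespace NCSeries

variable {α R : Type*} [CommRing R]

/-- The iterated left derivative: the coefficients at the words that start with `u`. -/
def pref (u : List α) (F : NCSeries α R) : NCSeries α R := fun w => F (u ++ w)

theorem pref_apply (u w : List α) (F : NCSeries α R) : pref u F w = F (u ++ w) := rfl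
@[simp] theorem pref_nil (F : NCSeries α R) : pref [] F = F := rfl
theorem D_eq_pref (i : α) (F : NCSeries α R) : D i F = pref [i] F := rfl

theorem D_pref (i : α) (u : List α) (F : NCSeries α R) :
    D i (pref u F) = pref (u ++ [i]) F := by
  ext w; simp [D_apply, pref_apply]

/-- The sum of `f_π g_{K(π)}` over the non-crossing partitions `π` of the positions of a word,
where `u` is put in front of the word at the block of the first position, and `v` in front of the
word at the block of the last position in the Kreweras complement, by recursion on the position
that follows the first one in its block. -/
noncomputable def ncRec (f g : NCSeries α R) (u v : List α) : List α → R
  | [] => f u * g v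
  | i :: w => f (u ++ [i]) * ncRec f g [] (v ++ [i]) w +
      ∑ k : Fin w.length, ncRec f g [] [i] (w.take k) * ncRec f g (u ++ [i]) v (w.drop k)
termination_by w => w.length
decreasing_by all_goals simp; try omega

/-- `ncRec` as a power series. -/
noncomputable def ncSeries (f g : NCSeries α R) (u v : List α) : NCSeries α R := ncRec f g u v

theorem ncSeries_nil (f g : NCSeries α R) (u v : List α) : ncSeries f g u v [] = f u * g v := by
  rw [ncSeries, ncRec]

/-- The first letter either closes its block, and then its primed copy joins the last block of the
complement, or the block continues after a gap. The subtracted constant removes the split with empty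
remainder, where the block would not continue. -/
theorem D_ncSeries (f g : NCSeries α R) (u v : List α) (i : α) :
    D i (ncSeries f g u v) = C (f (u ++ [i])) * ncSeries f g [] (v ++ [i]) +
      ncSeries f g [] [i] * (ncSeries f g (u ++ [i]) v - C (f (u ++ [i]) * g v)) := by
  ext w
  rw [add_apply, C_mul_apply, mul_apply, Finset.sum_range_succ, Finset.sum_range, D_apply]
  conv_lhs => rw [ncSeries, ncRec]
  rw [List.drop_length, sub_apply, C_nil, ncSeries_nil, sub_self, mul_zero, add_zero]
  congr 1
  refine Finset.sum_congr rfl fun k _ => ?_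
  rw [sub_apply]
  have : (C (f (u ++ [i]) * g v) : NCSeries α R) (w.drop k) = 0 := by
    have : w.drop k ≠ [] := by simp
    cases h : w.drop k with
    | nil => contradiction
    | cons j t => rfl
  rw [this, sub_zero]
  rfl

/-- The recursion determines each left derivative in degree `n` from values of degree at most `n`,
so it has only one solution. -/
theorem eq_ncSeries {f g : NCSeries α R} {E : List α → List α → NCSeries α R}
    (h0 : ∀ u v, E u v [] = f u * g v)
    (hD : ∀ u v i, D i (E u v) = C (f (u ++ [i])) * E [] (v ++ [i]) +
      E [] [i] * (E (u ++ [i]) v - C (f (u ++ [i]) * g v))) (u v : List α) :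
    E u v = ncSeries f g u v := by
  refine eq_of_agree fun n => ?_
  induction n generalizing u v with
  | zero => exact Agree.zero _ _
  | succ n ih =>
    intro w hw
    cases w with
    | nil => rw [h0, ncSeries_nil]
    | cons i w =>
      change D i (E u v) w = D i (ncSeries f g u v) w
      rw [hD, D_ncSeries]
      exact ((Agree.refl n _).mul (ih _ _)).add ((ih _ _).mul ((ih _ _).sub (Agree.refl _ _))) w
        (by simpa using hw)

/-- The boxed convolution. -/
noncomputable def box (f g : NCSeries α R) : NCSeries α R := ncSeries f g [] []

section System
variable [Fintype α] [DecidableEq α]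

/-- The series of the gaps after an element of a block of `π`. -/
noncomputable def gapL (f g : NCSeries α R) (i : α) : NCSeries α R := X i * ncSeries f g [] [i]

/-- The series of the gaps before an element of a block of `K(π)`. -/
noncomputable def gapR (f g : NCSeries α R) (i : α) : NCSeries α R :=
  subst (gapL f g) (RD i f) * X i

@[simp] theorem gapL_nil (f g : NCSeries α R) (i : α) : gapL f g i [] = 0 := X_mul_nil _ _
@[simp] theorem gapR_nil (f g : NCSeries α R) (i : α) : gapR f g i [] = 0 := mul_X_nil _ _

theorem box_nil (f g : NCSeries α R) (hf : f [] = 1) (hg : g [] = 1) : box f g [] = 1 := by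
  rw [box, ncSeries_nil, hf, hg, one_mul]

/-- When `v` is empty the part after the last element of the block has the same shape as the inner
gaps. Hence the closing term and the correction in `D_ncSeries` cancel, and every element of the
block is simply followed by a gap. -/
theorem ncSeries_eq_subst_gapL (f g : NCSeries α R) (hg : g [] = 1) (u : List α) :
    ncSeries f g u [] = subst (gapL f g) (pref u f) := by
  refine eq_subst_of_family (P := fun u => ncSeries f g u []) (F := fun u => pref u f)
    (gapL_nil f g) (fun i u => u ++ [i])
    (fun i u => D_pref i u f) (fun u => ?_) u
  rw [eq_C_add_sum (ncSeries f g u []), ncSeries_nil, hg, mul_one, pref_apply, List.append_nil]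
  congr 1
  refine Finset.sum_congr rfl fun i _ => ?_
  rw [D_ncSeries, gapL, hg, mul_one, List.nil_append, ← mul_C, ← mul_add, add_sub_cancel, mul_assoc]

/-- This isolates the next element of the last block of the complement together with everything in
front of it. -/
theorem ncSeries_eq_gapR (f g : NCSeries α R) (hf : f [] = 1) (v : List α) :
    ncSeries f g [] v = C (g v) + ∑ i, gapR f g i * ncSeries f g [] (v ++ [i]) := by
  -- Reading a letter of the first block changes `u`, so the identity is proved for all `u` at once
  -- and then used at the empty word.
  have key := eq_zero_of_eq_sum (Y := gapL f g) (gapL_nil f g) (fun i u => u ++ [i])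
    (P := fun u => ncSeries f g u v - C (f u * g v) -
      ∑ i, subst (gapL f g) (RD i (pref u f)) * (X i * ncSeries f g [] (v ++ [i])))
    (fun u => ?_) []
  · rw [sub_eq_zero, sub_eq_iff_eq_add, hf, one_mul, pref_nil] at key
    rw [key, add_comm]
    simp only [gapR, mul_assoc]
  · have h1 : ncSeries f g u v - C (f u * g v) =
        ∑ i, C (f (u ++ [i])) * (X i * ncSeries f g [] (v ++ [i])) +
          ∑ i, gapL f g i * (ncSeries f g (u ++ [i]) v - C (f (u ++ [i]) * g v)) := by
      conv_lhs => rw [eq_C_add_sum (ncSeries f g u v), ncSeries_nil, add_sub_cancel_left]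
      rw [← Finset.sum_add_distrib]
      refine Finset.sum_congr rfl fun i _ => ?_
      rw [D_ncSeries, mul_add, gapL, ← mul_assoc (X i) (C _), mul_C, mul_assoc, mul_assoc]
    have h2 : ∀ i, subst (gapL f g) (RD i (pref u f)) = C (f (u ++ [i])) +
        ∑ j, gapL f g j * subst (gapL f g) (RD i (pref (u ++ [j]) f)) := fun i => by
      rw [subst_eq (gapL_nil f g)]
      simp only [D_RD, D_pref]
      rfl
    rw [h1]
    simp only [h2, add_mul, Finset.sum_add_distrib, mul_sub, Finset.sum_sub_distrib,
      Finset.sum_mul, Finset.mul_sum, mul_assoc]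
    rw [Finset.sum_comm (f := fun i j => gapL f g j * (subst (gapL f g) (RD i (pref (u ++ [j]) f)) *
      (X i * ncSeries f g [] (v ++ [i]))))]
    abel

theorem ncSeries_eq_subst_gapR (f g : NCSeries α R) (hf : f [] = 1) (v : List α) :
    ncSeries f g [] v = subst (gapR f g) (pref v g) :=
  eq_subst_of_family (F := fun u => pref u g) (gapR_nil f g) (fun i u => u ++ [i])
    (fun i u => D_pref i u g) (fun v => by
      rw [pref_apply, List.append_nil]; exact ncSeries_eq_gapR f g hf v) v

theorem box_eq_left (f g : NCSeries α R) (hg : g [] = 1) : box f g = subst (gapL f g) f :=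
  ncSeries_eq_subst_gapL f g hg []

theorem box_eq_right (f g : NCSeries α R) (hf : f [] = 1) : box f g = subst (gapR f g) g :=
  ncSeries_eq_subst_gapR f g hf []

/-- Together with the definition of `gapR` this closes a system of two equations for the gap series
that no longer mentions `ncSeries`. -/
theorem gapL_eq (f g : NCSeries α R) (hf : f [] = 1) (i : α) :
    gapL f g i = X i * subst (gapR f g) (D i g) := by
  rw [gapL, ncSeries_eq_subst_gapR f g hf, D_eq_pref]

/-- What follows the first letter is the rest of its gap, then the rest of its block; each is a
substitution of gap series into a derivative. -/
theorem D_box (f g : NCSeries α R) (hf : f [] = 1) (hg : g [] = 1) (i : α) :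
    D i (box f g) = subst (gapR f g) (D i g) * subst (gapL f g) (D i f) := by
  rw [box_eq_left f g hg, subst_eq (gapL_nil f g)]
  conv_lhs => enter [2, 2, 2, i]; rw [gapL_eq f g hf, mul_assoc]
  rw [D_add, D_C, D_sum_X_mul, zero_add]

theorem RD_box (f g : NCSeries α R) (hf : f [] = 1) (i : α) :
    RD i (box f g) = subst (gapR f g) (RD i g) * subst (gapL f g) (RD i f) := by
  rw [box_eq_right f g hf, subst_eq_right (gapR_nil f g)]
  conv_lhs => enter [2, 2, 2, i]; rw [gapR, ← mul_assoc]
  have : ∀ (r : R) (F : NCSeries α R), RD i (C r + F) = RD i F := fun r F => by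
    ext w; cases w <;> simp [RD_apply, C]
  rw [this, RD_sum_mul_X]

/-- Each right-hand side contains a variable as an explicit factor, so agreement of the unknowns up
to some degree improves by one. -/
theorem triple_system_unique (f g k : NCSeries α R) {β μ Γ β' μ' Γ' : α → NCSeries α R}
    (h1 : ∀ i, β i = X i * (subst Γ (D i k) * subst μ (D i g)))
    (h2 : ∀ i, μ i = subst β (RD i f) * X i * subst Γ (D i k))
    (h3 : ∀ i, Γ i = subst μ (RD i g) * subst β (RD i f) * X i)
    (h1' : ∀ i, β' i = X i * (subst Γ' (D i k) * subst μ' (D i g)))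
    (h2' : ∀ i, μ' i = subst β' (RD i f) * X i * subst Γ' (D i k))
    (h3' : ∀ i, Γ' i = subst μ' (RD i g) * subst β' (RD i f) * X i) : β = β' := by
  have key : ∀ n, (∀ i, Agree n (β i) (β' i)) ∧ (∀ i, Agree n (μ i) (μ' i)) ∧
      ∀ i, Agree n (Γ i) (Γ' i) := by
    intro n
    induction n with
    | zero => exact ⟨fun _ => Agree.zero _ _, fun _ => Agree.zero _ _, fun _ => Agree.zero _ _⟩
    | succ n ih =>
      obtain ⟨hβ, hμ, hΓ⟩ := ih
      refine ⟨fun i => ?_, fun i => ?_, fun i => ?_⟩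
      · rw [h1, h1']
        exact Agree.X_mul i ((Agree.subst hΓ _).mul (Agree.subst hμ _))
      · rw [h2, h2', mul_assoc, mul_assoc]
        exact Agree.mul_right_succ (X_mul_nil _ _) (Agree.subst hβ _)
          (Agree.X_mul i (Agree.subst hΓ _))
      · rw [h3, h3']
        exact Agree.mul_X i ((Agree.subst hμ _).mul (Agree.subst hβ _))
  exact funext fun i => eq_of_agree fun n => (key n).1 i

/-- Both sides become a substitution into `f`. The substituted series solve the same system of three
equations; `D_box` and `RD_box` unfold the inner product in each bracketing. -/
theorem box_assoc (f g k : NCSeries α R) (hf : f [] = 1) (hg : g [] = 1) (hk : k [] = 1) :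
    box (box f g) k = box f (box g k) := by
  have hh := box_nil f g hf hg
  have hl := box_nil g k hg hk
  have n1 := gapL_nil (α := α) (R := R)
  have n2 := gapR_nil (α := α) (R := R)
  rw [(box_eq_left _ k hk).trans (congrArg _ (box_eq_left f g hg)),
    subst_subst (n1 _ _) (n1 _ _), box_eq_left f _ hl]
  congr 1
  refine triple_system_unique f g k
    (β := fun i => subst (gapL (box f g) k) (gapL f g i))
    (μ := fun i => subst (gapL (box f g) k) (gapR f g i)) (Γ := gapR (box f g) k)
    (β' := gapL f (box g k))
    (μ' := fun i => subst (gapR f (box g k)) (gapL g k i))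
    (Γ' := fun i => subst (gapR f (box g k)) (gapR g k i)) ?_ ?_ ?_ ?_ ?_ ?_ <;> intro i
  · rw [gapL_eq f g hf, subst_mul (n1 _ _), subst_X (n1 _ _), gapL_eq _ k hh,
      subst_subst (n2 _ _) (n1 _ _), mul_assoc]
  · rw [gapR, subst_mul (n1 _ _), subst_X (n1 _ _), gapL_eq _ k hh,
      subst_subst (n1 _ _) (n1 _ _), mul_assoc]
  · rw [gapR, RD_box f g hf, subst_mul (n1 _ _), subst_subst (n1 _ _) (n1 _ _),
      subst_subst (n2 _ _) (n1 _ _)]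
  · rw [gapL_eq f _ hf, D_box g k hg hk, subst_mul (n2 _ _), subst_subst (n2 _ _) (n2 _ _),
      subst_subst (n1 _ _) (n2 _ _)]
  · rw [gapL_eq g k hg, subst_mul (n2 _ _), subst_X (n2 _ _), subst_subst (n2 _ _) (n2 _ _), gapR]
  · conv_lhs => rw [gapR, subst_mul (n2 _ _), subst_X (n2 _ _), subst_subst (n1 _ _) (n2 _ _), gapR]
    rw [mul_assoc]

/-! ### The unit and the Möbius series -/

/-- The sum of the variables. -/
def sumX (α R : Type*) [CommRing R] [Fintype α] [DecidableEq α] : NCSeries α R := ∑ i, X i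

theorem D_one_add_sumX (i : α) : D i (1 + sumX α R) = 1 := by
  rw [D_add, D_one, zero_add, sumX]
  simpa using D_sum_X_mul i (fun _ => (1 : NCSeries α R))

theorem RD_one_add_sumX (i : α) : RD i (1 + sumX α R) = 1 := by
  have h := RD_sum_mul_X i (fun _ => (1 : NCSeries α R))
  simp only [one_mul] at h
  ext w
  rw [RD_apply, add_apply, sumX, ← RD_apply (∑ i, X i), h]
  cases w <;> simp [← C_one, C]

theorem sumX_nil : sumX α R [] = 0 := by simp [sumX, sum_apply]

theorem one_add_sumX_nil : (1 + sumX α R) [] = 1 := by simp [sumX_nil]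

theorem box_one (f : NCSeries α R) (hf : f [] = 1) : box f (1 + sumX α R) = f := by
  have h : gapL f (1 + sumX α R) = X := funext fun i => by
    rw [gapL_eq f _ hf, D_one_add_sumX, subst_one (gapR_nil _ _), mul_one]
  rw [box_eq_left _ _ one_add_sumX_nil, h, subst_X_self]

theorem one_box (f : NCSeries α R) : box (1 + sumX α R) f = f := by
  have h : gapR (1 + sumX α R) f = X := funext fun i => by
    rw [gapR, RD_one_add_sumX, subst_one (gapL_nil _ _), one_mul]
  rw [box_eq_right _ _ one_add_sumX_nil, h, subst_X_self]

/-- The series with all coefficients `1`. -/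
def ones (α R : Type*) [CommRing R] : NCSeries α R := fun _ => 1

/-- All left derivatives of `ones` are `ones` again, so each gap carries a copy of the whole series.
This is the moment-cumulant equation. -/
theorem box_ones (f : NCSeries α R) (hf : f [] = 1) :
    box f (ones α R) = subst (fun i => X i * box f (ones α R)) f := by
  conv_lhs => rw [box_eq_left f _ rfl]
  congr 1
  funext i
  rw [gapL_eq f _ hf, box_eq_right f _ hf]
  rfl

theorem ones_box (f : NCSeries α R) (hf : f [] = 1) :
    box (ones α R) f = subst (fun i => box (ones α R) f * X i) f := by
  conv_lhs => rw [box_eq_right _ f rfl]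
  congr 1
  funext i
  rw [gapR, box_eq_left _ f hf]
  rfl

theorem eq_of_eq_subst_X_mul {F H H' : NCSeries α R} (h : H = subst (fun i => X i * H) F)
    (h' : H' = subst (fun i => X i * H') F) : H = H' := by
  have hc : Contraction fun (P : Unit → NCSeries α R) x => subst (fun i => X i * P x) F :=
    fun _ _ _ h x => Agree.subst (fun i => Agree.X_mul i (h x)) F
  exact congrFun (hc.unique (P := fun _ => H) (Q := fun _ => H') (funext fun _ => h)
    (funext fun _ => h')) ()

theorem eq_of_eq_subst_mul_X {F H H' : NCSeries α R} (h : H = subst (fun i => H * X i) F)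
    (h' : H' = subst (fun i => H' * X i) F) : H = H' := by
  have hc : Contraction fun (P : Unit → NCSeries α R) x => subst (fun i => P x * X i) F :=
    fun _ _ _ h x => Agree.subst (fun i => Agree.mul_X i (h x)) F
  exact congrFun (hc.unique (P := fun _ => H) (Q := fun _ => H') (funext fun _ => h)
    (funext fun _ => h')) ()

theorem Agree.mul_of_nil {n : ℕ} {S F F' : NCSeries α R} (hS : S [] = 0) (h : Agree n F F') :
    Agree (n + 1) (S * F) (S * F') :=
  Agree.mul_left_succ hS (Agree.refl _ _) h

/-- With `σ` the sum of the variables, take `M = 1 + qσ` where `q = 1 - σq²`. Replacing `xᵢ` by `(1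
+ σ)xᵢ` sends `σ` to `(1 + σ)σ`, and the transformed quadratic equation is solved by `V = (1 +
σ)⁻¹`, so `M` goes to `1 + V(1 + σ)σ = 1 + σ`. As `σ` and `1 + σ` commute, replacing `xᵢ` by `xᵢ(1 +
σ)` has the same effect. -/
theorem exists_moebius : ∃ M : NCSeries α R, M [] = 1 ∧
    subst (fun i => (1 + sumX α R) * X i) M = 1 + sumX α R ∧
    subst (fun i => X i * (1 + sumX α R)) M = 1 + sumX α R := by
  set σ := sumX α R with hσ
  have hσ0 : σ [] = 0 := sumX_nil
  have hquad : ∀ S : NCSeries α R, S [] = 0 → Contraction fun (P : Unit → NCSeries α R) x =>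
      1 - S * (P x * P x) := fun S hS n P Q h x =>
    (Agree.refl _ _).sub (Agree.mul_of_nil hS ((h x).mul (h x)))
  obtain ⟨q, hq⟩ := (hquad σ hσ0).exists
  replace hq := congrFun hq ()
  generalize q () = q at hq
  have hlin : Contraction fun (P : Unit → NCSeries α R) x => 1 - σ * P x := fun n P Q h x =>
    (Agree.refl _ _).sub (Agree.mul_of_nil hσ0 (h x))
  obtain ⟨V, hV⟩ := hlin.exists
  replace hV := congrFun hV ()
  generalize V () = V at hV
  have hUV : (1 + σ) * V = 1 := by
    rw [add_mul, one_mul]; nth_rewrite 1 [hV]; abel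
  have hVU : V * (1 + σ) = 1 := by
    -- The equation for `V` gives a right inverse directly; for the left inverse, `V(1 + σ)` and `1`
    -- solve the same linear contraction.
    have hc : Contraction fun (P : Unit → NCSeries α R) x => 1 + σ - σ * P x := fun n P Q h x =>
      (Agree.refl _ _).sub (Agree.mul_of_nil hσ0 (h x))
    refine congrFun (hc.unique (P := fun _ => V * (1 + σ)) (Q := fun _ => 1)
      (funext fun _ => ?_) (funext fun _ => ?_)) ()
    · nth_rewrite 1 [hV]
      rw [sub_mul, one_mul, mul_assoc]
    · rw [mul_one]; abel
  have hcomm : (1 + σ) * σ = σ * (1 + σ) := by rw [add_mul, mul_add, one_mul, mul_one]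
  have key : ∀ Y : α → NCSeries α R, (∀ i, Y i [] = 0) → subst Y σ = (1 + σ) * σ →
      subst Y (1 + q * σ) = 1 + σ := by
    intro Y hY hYσ
    have hQ : subst Y q = 1 - (1 + σ) * σ * (subst Y q * subst Y q) := by
      conv_lhs => rw [hq]
      have h1 : subst Y (1 - σ * (q * q)) + subst Y (σ * (q * q)) = 1 := by
        rw [← subst_add hY, sub_add_cancel, subst_one hY]
      rw [eq_sub_of_add_eq h1, subst_mul hY, subst_mul hY, hYσ]
    have hS : ((1 + σ) * σ) [] = 0 := by rw [mul_nil, hσ0, mul_zero]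
    have hVS : V = 1 - (1 + σ) * σ * (V * V) := by
      rw [hcomm, mul_assoc, ← mul_assoc (1 + σ), hUV, one_mul]
      exact hV
    have hQV : subst Y q = V := congrFun ((hquad _ hS).unique (P := fun _ => subst Y q)
      (Q := fun _ => V) (funext fun _ => hQ) (funext fun _ => hVS)) ()
    rw [subst_add hY, subst_one hY, subst_mul hY, hYσ, hQV, ← mul_assoc, hVU, one_mul]
  refine ⟨1 + q * σ, by simp [hσ0], key _ (by simp) ?_, key _ (by simp) ?_⟩
  · rw [hσ, sumX, subst_sum (by simp), Finset.mul_sum]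
    exact Finset.sum_congr rfl fun i _ => subst_X (by simp) i
  · rw [hcomm]
    conv_lhs => rw [hσ, sumX, subst_sum (by simp)]
    conv_rhs => rw [hσ, sumX, Finset.sum_mul, ← sumX]
    exact Finset.sum_congr rfl fun i _ => subst_X (by simp) i

theorem exists_box_inverse_ones : ∃ M : NCSeries α R, M [] = 1 ∧
    box (ones α R) M = 1 + sumX α R ∧ box M (ones α R) = 1 + sumX α R := by
  obtain ⟨M, hM, h1, h2⟩ := exists_moebius (α := α) (R := R)
  exact ⟨M, hM, eq_of_eq_subst_mul_X (ones_box M hM) h1.symm,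
    eq_of_eq_subst_X_mul (box_ones M hM) h2.symm⟩

end System

end NCSeries

/-! ### Moments of free families -/

namespace NCSeries

variable {α R : Type*} [CommRing R] [Fintype α] [DecidableEq α]

/-- The sum over the completions, with independent gaps of moments `G`, of an open block `u` of
variables with cumulants `κ`. -/
noncomputable def openBlock (κ : NCSeries α R) (G : NCSeries (α ⊕ α) R) (u : List α) :
    NCSeries (α ⊕ α) R :=
  subst (fun i => G * X (Sum.inl i)) (pref u κ)

theorem mul_X_inl_nil (G : NCSeries (α ⊕ α) R) (i : α) :
    (G * X (Sum.inl i) : NCSeries (α ⊕ α) R) [] = 0 :=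
  mul_X_nil _ _

/-- The equation reads the first letter. A letter `xᵢ` opens a block of cumulants whose gaps start
afresh with the empty word, while `v` is kept for what follows the block; a letter `yᵢ` is appended
to `v`. -/
theorem contraction_freeMoment (κ g : NCSeries α R) :
    Contraction fun (P : List α → NCSeries (α ⊕ α) R) v => C (g v) + ∑ z, X z *
      Sum.elim (fun i => openBlock κ (P []) [i] * P v) (fun i => P (v ++ [i])) z :=
  fun _ _ _ h v => (Agree.refl _ _).add <| Agree.sum fun z => Agree.X_mul z <| by
    cases z with
    | inl i => exact (Agree.subst (fun j => (h []).mul (Agree.refl _ _)) _).mul (h v)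
    | inr i => exact h _

/-- The moments of a family with cumulants `κ` that is free from a family with moments `g`; the
variables of the second family are preceded by the word `v`. -/
noncomputable def freeMoment (κ g : NCSeries α R) : List α → NCSeries (α ⊕ α) R :=
  (contraction_freeMoment κ g).exists.choose

theorem freeMoment_eq (κ g : NCSeries α R) (v : List α) :
    freeMoment κ g v = C (g v) + ∑ z, X z *
      Sum.elim (fun i => openBlock κ (freeMoment κ g []) [i] * freeMoment κ g v)
        (fun i => freeMoment κ g (v ++ [i])) z :=
  congrFun (contraction_freeMoment κ g).exists.choose_spec v

variable (κ g : NCSeries α R)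

theorem freeMoment_nil (v : List α) : freeMoment κ g v [] = g v := by
  rw [freeMoment_eq, add_apply, sum_X_mul_nil, C_nil, add_zero]

theorem D_inl_freeMoment (v : List α) (i : α) : D (Sum.inl i) (freeMoment κ g v) =
    openBlock κ (freeMoment κ g []) [i] * freeMoment κ g v := by
  conv_lhs => rw [freeMoment_eq, D_add, D_C, D_sum_X_mul, zero_add, Sum.elim_inl]

theorem D_inr_freeMoment (v : List α) (i : α) :
    D (Sum.inr i) (freeMoment κ g v) = freeMoment κ g (v ++ [i]) := by
  conv_lhs => rw [freeMoment_eq, D_add, D_C, D_sum_X_mul, zero_add, Sum.elim_inr]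

/-- As no word of `N` starts with a `y`, reading `y`-letters never reaches the second factor. -/
theorem pref_inr_freeMoment_mul {N : NCSeries (α ⊕ α) R} (hN : ∀ i, D (Sum.inr i) N = 0)
    (b : List α) :
    pref (b.map Sum.inr) (freeMoment κ g [] * N) = freeMoment κ g b * N := by
  induction b using List.reverseRecOn with
  | nil => rfl
  | append_singleton b i ih =>
    rw [List.map_append, List.map_singleton, ← D_pref, ih, D_mul, D_inr_freeMoment, hN, mul_zero,
      add_zero]

theorem freeMoment_map_inr (b : List α) : freeMoment κ g [] (b.map Sum.inr) = g b := by
  have h := pref_inr_freeMoment_mul κ g (N := 1) (fun _ => D_one _) b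
  rw [mul_one, mul_one] at h
  rw [← freeMoment_nil κ g b, ← h, pref_apply, List.append_nil]

/-! ### Freeness: centered alternating products vanish -/

/-- The condition on `Γ` that makes the derivatives by centered words of the first family
insert a gap. -/
def AcceptsLeft (Γ : NCSeries (α ⊕ α) R) : Prop :=
  ∀ i, D (Sum.inl i) Γ = openBlock κ (freeMoment κ g []) [i] * Γ

/-- The condition on `Γ` that makes the derivatives by centered words of the second family
kill the gap. -/
def AcceptsRight (Γ : NCSeries (α ⊕ α) R) : Prop :=
  ∃ N : NCSeries (α ⊕ α) R, (∀ i, D (Sum.inr i) N = 0) ∧ Γ = freeMoment κ g [] * N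

theorem acceptsLeft_freeMoment (v : List α) : AcceptsLeft κ g (freeMoment κ g v) :=
  D_inl_freeMoment κ g v

theorem acceptsRight_freeMoment : AcceptsRight κ g (freeMoment κ g []) :=
  ⟨1, fun _ => D_one _, (mul_one _).symm⟩

theorem subst_mul_X_eq (G : NCSeries (α ⊕ α) R) (H : NCSeries α R) :
    subst (fun i => G * X (Sum.inl i)) H =
      C (H []) + G * ∑ i, X (Sum.inl i) * subst (fun i => G * X (Sum.inl i)) (D i H) := by
  conv_lhs => rw [subst_eq (mul_X_inl_nil G)]
  simp only [Finset.mul_sum, mul_assoc]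

theorem D_inr_sum_inl (H : α → NCSeries (α ⊕ α) R) (j : α) :
    D (Sum.inr j) (∑ i, X (Sum.inl i) * H i) = 0 := by
  rw [D_sum]
  exact Finset.sum_eq_zero fun i _ => by rw [D_X_mul, if_neg (by simp)]

theorem D_inl_sum_inl (H : α → NCSeries (α ⊕ α) R) (j : α) :
    D (Sum.inl j) (∑ i, X (Sum.inl i) * H i) = H j := by
  rw [D_sum]
  simp [D_X_mul]

/-- The series `H` depends on `a` but not on `Γ`: it collects the blocks left open by `a`. A further
letter `j` either opens a new block (`D j κ * H`) or continues the innermost open one (`D j H`). -/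
theorem exists_pref_inl (hg : g [] = 1) (a : List α) : ∃ H : NCSeries α R, ∀ Γ,
    AcceptsLeft κ g Γ → pref (a.map Sum.inl) Γ =
      subst (fun i => freeMoment κ g [] * X (Sum.inl i)) H * Γ := by
  have hY := mul_X_inl_nil (freeMoment κ g [])
  induction a using List.reverseRecOn with
  | nil => exact ⟨1, fun Γ _ => by rw [subst_one hY, one_mul]; rfl⟩
  | append_singleton a j ih =>
    obtain ⟨H, hH⟩ := ih
    refine ⟨D j κ * H + D j H, fun Γ hΓ => ?_⟩
    rw [List.map_append, List.map_singleton, ← D_pref, hH Γ hΓ, D_mul, hΓ j, subst_nil hY,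
      subst_add hY, subst_mul hY, D_eq_pref j κ]
    have h1 : D (Sum.inl j) (subst (fun i => freeMoment κ g [] * X (Sum.inl i)) H) =
        openBlock κ (freeMoment κ g []) [j] *
          (subst (fun i => freeMoment κ g [] * X (Sum.inl i)) H - C (H [])) +
        subst (fun i => freeMoment κ g [] * X (Sum.inl i)) (D j H) := by
      rw [subst_mul_X_eq _ H, D_add, D_C, zero_add, D_mul, D_inl_freeMoment, freeMoment_nil, hg,
        C_one, one_mul, D_inl_sum_inl, add_sub_cancel_left, mul_assoc]
    rw [h1, openBlock, ← mul_assoc (C (H [])), ← mul_C]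
    noncomm_ring

/-- Centering subtracts exactly the constant term of `H`, the case in which all blocks of `a` are
closed. In what remains some block is open, so the series is the gap series times a series whose
words start with an `x`. -/
theorem AcceptsLeft.right {Γ : NCSeries (α ⊕ α) R} (hg : g [] = 1) (h : AcceptsLeft κ g Γ)
    (a : List α) :
    AcceptsRight κ g (pref (a.map Sum.inl) Γ - C (freeMoment κ g [] (a.map Sum.inl)) * Γ) ∧
      (pref (a.map Sum.inl) Γ - C (freeMoment κ g [] (a.map Sum.inl)) * Γ :
        NCSeries (α ⊕ α) R) [] = 0 := by
  obtain ⟨H, hH⟩ := exists_pref_inl κ g hg a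
  have hY := mul_X_inl_nil (freeMoment κ g [])
  have h0 : freeMoment κ g [] (a.map Sum.inl) = H [] := by
    have := congrFun (hH _ (acceptsLeft_freeMoment κ g [])) []
    rwa [pref_apply, List.append_nil, mul_nil, subst_nil hY, freeMoment_nil, hg, mul_one] at this
  have key : pref (a.map Sum.inl) Γ - C (freeMoment κ g [] (a.map Sum.inl)) * Γ =
      freeMoment κ g [] * ∑ i, X (Sum.inl i) *
        (subst (fun i => freeMoment κ g [] * X (Sum.inl i)) (D i H) * Γ) := by
    rw [hH Γ h, subst_mul_X_eq, h0, add_mul, add_sub_cancel_left, mul_assoc, Finset.sum_mul]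
    simp only [mul_assoc]
  refine ⟨⟨_, D_inr_sum_inl _, key⟩, ?_⟩
  rw [key, mul_nil, sum_apply]
  simp

/-- The centered series is `(G_b - g(b) G) N`, where `G_b` stands for `freeMoment κ g b` and `G` for
the case of the empty word. Its first factor has no constant term, so an `x`-derivative falls on
that factor alone. -/
theorem AcceptsRight.left {Γ : NCSeries (α ⊕ α) R} (hg : g [] = 1) (h : AcceptsRight κ g Γ)
    (b : List α) :
    AcceptsLeft κ g (pref (b.map Sum.inr) Γ - C (freeMoment κ g [] (b.map Sum.inr)) * Γ) ∧
      (pref (b.map Sum.inr) Γ - C (freeMoment κ g [] (b.map Sum.inr)) * Γ :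
        NCSeries (α ⊕ α) R) [] = 0 := by
  obtain ⟨N, hN, rfl⟩ := h
  rw [pref_inr_freeMoment_mul κ g hN, freeMoment_map_inr]
  refine ⟨fun i => ?_, ?_⟩
  · rw [D_sub, D_mul, D_mul, D_mul, D_C, D_inl_freeMoment, D_inl_freeMoment, freeMoment_nil,
      freeMoment_nil, hg, C_one, C_nil, zero_mul, zero_add, mul_sub, ← mul_assoc _ (C (g b)),
      mul_C _ (g b)]
    noncomm_ring
  · simp [freeMoment_nil, hg]

/-- The word of an element of the free product that is a monomial of one of the two factors. -/
def itemWord : List α ⊕ List α → List (α ⊕ α) := Sum.elim (List.map Sum.inl) (List.map Sum.inr)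

/-- The value of a functional at a product of monomials, centered with respect to `G`. -/
def centered (G : NCSeries (α ⊕ α) R) :
    List (List α ⊕ List α) → NCSeries (α ⊕ α) R → R
  | [], Γ => Γ []
  | c :: l, Γ => centered G l (pref (itemWord c) Γ - C (G (itemWord c)) * Γ)

/-- Each centered factor turns one of the two conditions into the other, which is the one needed by
the next factor of an alternating product, and leaves a zero constant term behind. -/
theorem centered_eq_zero_of_accepts (hg : g [] = 1) (l : List (List α ⊕ List α))
    (hl : l.IsChain fun c d => c.isLeft ≠ d.isLeft) (Γ : NCSeries (α ⊕ α) R)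
    (h0 : l = [] → Γ [] = 0)
    (h1 : (∃ c, l.head? = some (Sum.inl c)) → AcceptsLeft κ g Γ)
    (h2 : (∃ c, l.head? = some (Sum.inr c)) → AcceptsRight κ g Γ) :
    centered (freeMoment κ g []) l Γ = 0 := by
  induction l generalizing Γ with
  | nil => exact h0 rfl
  | cons c l ih =>
    have hl' := hl.tail
    cases c with
    | inl a =>
      obtain ⟨h3, h4⟩ := (h1 ⟨a, rfl⟩).right κ g hg a
      refine ih hl' _ (fun _ => h4) ?_ fun _ => h3
      rintro ⟨c, hc⟩
      cases l with
      | nil => simp at hc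
      | cons d l => simp at hc; subst hc; simp at hl
    | inr b =>
      obtain ⟨h3, h4⟩ := (h2 ⟨b, rfl⟩).left κ g hg b
      refine ih hl' _ (fun _ => h4) (fun _ => h3) ?_
      rintro ⟨c, hc⟩
      cases l with
      | nil => simp at hc
      | cons d l => simp at hc; subst hc; simp at hl

/-- The two families are free. -/
theorem centered_freeMoment (hg : g [] = 1) (l : List (List α ⊕ List α)) (hl0 : l ≠ [])
    (hl : l.IsChain fun c d => c.isLeft ≠ d.isLeft) :
    centered (freeMoment κ g []) l (freeMoment κ g []) = 0 :=
  centered_eq_zero_of_accepts κ g hg l hl _ (fun h => absurd h hl0)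
    (fun _ => acceptsLeft_freeMoment κ g []) fun _ => acceptsRight_freeMoment κ g

/-! ### Restriction to the first family -/

theorem sum_elim_mul_nil (i : α ⊕ α) : (Sum.elim X (fun _ => 0) i : NCSeries α R) [] = 0 := by
  cases i <;> simp

theorem subst_elim_apply (F : NCSeries (α ⊕ α) R) (w : List α) :
    subst (Sum.elim X fun _ => 0) F w = F (w.map Sum.inl) := by
  induction w generalizing F with
  | nil => exact subst_nil sum_elim_mul_nil F
  | cons i w ih =>
    rw [cons_apply (subst _ F), subst_eq sum_elim_mul_nil, D_add, D_C, zero_add, Fintype.sum_sum_type]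
    simp only [Sum.elim_inl, Sum.elim_inr, zero_mul, Finset.sum_const_zero, add_zero]
    rw [D_sum_X_mul, ih]
    rfl

/-- Setting all `yᵢ` to zero turns the equation of `freeMoment` into the moment-cumulant equation of
`box_ones`, after moving the gap series across the block. -/
theorem freeMoment_map_inl (hg : g [] = 1) (hκ : κ [] = 1) (w : List α) :
    freeMoment κ g [] (w.map Sum.inl) = box κ (ones α R) w := by
  have hZ := sum_elim_mul_nil (α := α) (R := R)
  refine (subst_elim_apply _ _).symm.trans (congrFun (eq_of_eq_subst_X_mul (F := κ) ?_ (box_ones κ hκ)) w)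
  set G' := subst (Sum.elim X fun _ => 0) (freeMoment κ g []) with hG'
  rw [subst_eq (fun i => X_mul_nil i G'), hκ]
  conv_lhs => rw [hG', subst_eq hZ, freeMoment_nil, hg, Fintype.sum_sum_type]
  simp only [Sum.elim_inl, Sum.elim_inr, zero_mul, Finset.sum_const_zero, add_zero]
  congr 1
  refine Finset.sum_congr rfl fun i _ => ?_
  rw [D_inl_freeMoment, subst_mul hZ, openBlock, subst_subst (mul_X_inl_nil _) hZ, ← hG', mul_assoc,
    ← D_eq_pref]
  congr 1
  refine subst_mul_shift G' (fun i => ?_) (fun i => X_mul_nil i G') (fun i => ?_) _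
  · rw [subst_nil hZ, mul_X_inl_nil]
  · rw [subst_mul hZ, subst_X hZ, ← hG', Sum.elim_inl, mul_assoc]

/-! ### Restriction to doubled words -/

/-- The word `x₁ y₁ x₂ y₂ ⋯`. -/
def double (u : List α) : List (α ⊕ α) := u.flatMap fun i => [Sum.inl i, Sum.inr i]

/-- The coefficients at the words `x₁ y₁ x₂ y₂ ⋯`. -/
def alongDouble (F : NCSeries (α ⊕ α) R) : NCSeries α R := fun u => F (double u)

theorem alongDouble_nil (F : NCSeries (α ⊕ α) R) : alongDouble F [] = F [] := rfl

theorem D_alongDouble (F : NCSeries (α ⊕ α) R) (i : α) :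
    D i (alongDouble F) = alongDouble (D (Sum.inr i) (D (Sum.inl i) F)) := rfl

theorem alongDouble_add (F G : NCSeries (α ⊕ α) R) :
    alongDouble (F + G) = alongDouble F + alongDouble G := rfl

theorem alongDouble_C_mul (r : R) (F : NCSeries (α ⊕ α) R) :
    alongDouble (C r * F) = C r * alongDouble F := by
  ext w
  rw [C_mul_apply, alongDouble, C_mul_apply]; rfl

/-- A cut of a doubled word between `xᵢ` and `yᵢ` leaves a right part starting with a `y`, where `N`
vanishes; only cuts between doubled letters remain. -/
theorem alongDouble_mul (F : NCSeries (α ⊕ α) R) {N : NCSeries (α ⊕ α) R}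
    (hN : ∀ i, D (Sum.inr i) N = 0) : alongDouble (F * N) = alongDouble F * alongDouble N := by
  ext w
  induction w generalizing F with
  | nil => rfl
  | cons i w ih =>
    rw [cons_apply (alongDouble (F * N)), D_alongDouble, D_mul, D_add, D_mul, D_mul, D_C, zero_mul, zero_add, hN,
      mul_zero, add_zero, C_nil, alongDouble_add, alongDouble_C_mul, add_apply, ih, mul_cons,
      C_mul_apply, D_alongDouble, cons_apply (alongDouble N), D_alongDouble, alongDouble_nil]

theorem alongDouble_sum_inl (H : α → NCSeries (α ⊕ α) R) :
    alongDouble (∑ i, X (Sum.inl i) * H i) = ∑ i, X i * alongDouble (D (Sum.inr i) (H i)) := by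
  refine ext_D ?_ fun i => ?_
  · rw [alongDouble_nil, sum_apply, sum_apply]; simp
  · rw [D_alongDouble, D_inl_sum_inl, D_sum_X_mul]

theorem alongDouble_freeMoment (hκ : κ [] = 1) : alongDouble (freeMoment κ g []) = box κ g := by
  set G := freeMoment κ g [] with hG
  -- `E u v` allows for an open block that already contains `u`: either nothing follows, or the next
  -- letter `xⱼ` joins this block and `yⱼ` is read after it.
  let E : List α → List α → NCSeries α R := fun u v => C (κ u * g v) +
    ∑ j, X j * alongDouble (D (Sum.inr j) (openBlock κ G (u ++ [j]) * freeMoment κ g v))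
  have hE : ∀ v, E [] v = alongDouble (freeMoment κ g v) := fun v => by
    refine ext_D ?_ fun i => ?_
    · simp only [E]
      rw [add_apply, sum_X_mul_nil, C_nil, hκ, one_mul, add_zero, alongDouble_nil, freeMoment_nil]
    · simp only [E]
      rw [D_add, D_C, D_sum_X_mul, zero_add, D_alongDouble, D_inl_freeMoment]
      rfl
  rw [← hE, box]
  refine eq_ncSeries (E := E) (fun u v => ?_) (fun u v i => ?_) [] []
  · simp only [E]
    rw [add_apply, sum_X_mul_nil, C_nil, add_zero]
  · rw [hE, hE]
    simp only [E]
    rw [D_add, D_C, D_sum_X_mul, zero_add, add_sub_cancel_left, ← alongDouble_sum_inl,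
      ← alongDouble_mul _ (D_inr_sum_inl _), ← alongDouble_C_mul, ← alongDouble_add]
    congr 1
    -- The two terms of the recursion: if the block closes at `xᵢ`, then `yᵢ` is appended to `v`;
    -- otherwise `yᵢ` begins the gap before the next letter of the block.
    rw [openBlock, subst_mul_X_eq, pref_apply, List.append_nil, add_mul, D_add, D_mul, D_C,
      zero_mul, zero_add, C_nil, D_inr_freeMoment, mul_assoc, D_mul, hG, D_inr_freeMoment,
      List.nil_append, Finset.sum_mul]
    simp only [mul_assoc, D_inr_sum_inl, mul_zero, add_zero, D_pref]
    rfl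

end NCSeries

/-! ### Centered products expanded over sets of positions -/

namespace FreeConv

theorem sublistAt_map_succ {C : Type*} (c : C) (l : List C) (J : Finset (Fin l.length)) :
    sublistAt (c :: l) (J.map (Fin.succEmb l.length)) = sublistAt l J := by
  unfold sublistAt
  have h : (J.map (Fin.succEmb l.length)).sort (· ≤ ·) = (J.sort (· ≤ ·)).map Fin.succ :=
    (Finset.map_sort (r := (· ≤ ·)) (r' := (· ≤ ·)) (Fin.succEmb l.length) J
      fun _ _ _ _ => by simp).symm
  refine (congrArg (List.map (c :: l).get) h).trans ?_
  rw [List.map_map]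
  rfl

theorem sublistAt_insert_zero {C : Type*} (c : C) (l : List C) (J : Finset (Fin l.length)) :
    sublistAt (c :: l) (insert 0 (J.map (Fin.succEmb l.length))) = c :: sublistAt l J := by
  rw [← sublistAt_map_succ c l J]
  unfold sublistAt
  have h := Finset.sort_insert (r := (· ≤ ·)) (s := J.map (Fin.succEmb l.length))
    (fun b _ => Fin.zero_le b) (by simp)
  exact congrArg (List.map (c :: l).get) h

theorem sublistAt_univ {C : Type*} (l : List C) : sublistAt l Finset.univ = l := by
  induction l with
  | nil => simp [sublistAt]
  | cons c l ih =>
    have : (Finset.univ : Finset (Fin (c :: l).length)) =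
        insert 0 (Finset.univ.map (Fin.succEmb l.length)) := by
      ext i
      refine Fin.cases ?_ (fun j => ?_) i <;> simp
    rw [this, sublistAt_insert_zero, ih]

theorem sublistAt_map {C C' : Type*} (m : C → C') (l : List C) (I : Finset (Fin l.length)) :
    sublistAt (l.map m) (I.map (finCongr (List.length_map m).symm).toEmbedding) =
      (sublistAt l I).map m := by
  unfold sublistAt
  have h := (Finset.map_sort (r := (· ≤ ·)) (r' := (· ≤ ·))
    (finCongr (List.length_map (as := l) m).symm).toEmbedding I fun _ _ _ _ => by simp).symm
  rw [h, List.map_map, List.map_map]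
  refine List.map_congr_left fun i _ => ?_
  simp

theorem sum_finset_fin_succ {M : Type*} [AddCommMonoid M] {n : ℕ} (F : Finset (Fin (n + 1)) → M) :
    ∑ I, F I = ∑ J : Finset (Fin n),
      (F (J.map (Fin.succEmb n)) + F (insert 0 (J.map (Fin.succEmb n)))) := by
  classical
  have h : (Finset.univ : Finset (Fin (n + 1))) = insert 0 (Finset.univ.image Fin.succ) := by
    ext i
    refine Fin.cases ?_ (fun j => ?_) i <;> simp
  rw [← Finset.powerset_univ, h, Finset.sum_powerset_insert (by simp),
    Finset.powerset_image, Finset.sum_image, Finset.sum_image, Finset.powerset_univ,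
    ← Finset.sum_add_distrib]
  · simp only [Finset.map_eq_image]
    rfl
  all_goals exact (Finset.image_injective (Fin.succ_injective n)).injOn

end FreeConv

namespace NCSeries

open FreeConv

variable {α R : Type*} [CommRing R]

/-- Each centered factor is a difference of two operators on `Γ`; `I` is the set of positions where
the first of them, reading the word, is chosen. -/
theorem centered_eq_sum (G : NCSeries (α ⊕ α) R) (l : List (List α ⊕ List α))
    (Γ : NCSeries (α ⊕ α) R) :
    centered G l Γ = ∑ I : Finset (Fin l.length), Γ ((sublistAt l I).flatMap itemWord) *
      ∏ i, if i ∈ I then 1 else -G (itemWord (l.get i)) := by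
  induction l generalizing Γ with
  | nil =>
    have h : ∀ I : Finset (Fin ([] : List (List α ⊕ List α)).length), sublistAt [] I = [] :=
      fun I => List.eq_nil_of_length_eq_zero (by
        rw [sublistAt, List.length_map, Finset.length_sort, Finset.card_eq_zero]
        exact Finset.eq_empty_of_forall_notMem fun i => Fin.elim0 i)
    simp only [centered, h]
    simp
  | cons c l ih =>
    refine (ih _).trans ((sum_finset_fin_succ _).trans (Finset.sum_congr rfl fun J _ => ?_)).symm
    rw [sublistAt_map_succ, sublistAt_insert_zero]
    refine (congrArg₂ (· + ·) (congrArg _ (Fin.prod_univ_succ _))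
      (congrArg _ (Fin.prod_univ_succ _))).trans ?_
    simp only [sub_apply, C_mul_apply, pref_apply]
    simp
    ring

end NCSeries

/-! ### From vanishing centered products to the recursion of the free product -/

namespace FreeConv

open NCSeries

variable {α R : Type*} [CommRing R]

/-- The monomial of a word. -/
noncomputable def monomial (R : Type*) [CommRing R] (a : List α) : FreeAlgebra R α :=
  (a.map (FreeAlgebra.ι R)).prod

/-- A monomial in one of the two factors of the free product. -/
noncomputable def itemMonomial (R : Type*) [CommRing R] :
    List α ⊕ List α → FreeAlgebra R α ⊕ FreeAlgebra R α :=
  Sum.map (monomial R) (monomial R)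

/-- Contraction of monomials can be followed on words: neighbouring words of one family are
concatenated, so the total word is unchanged while the list becomes alternating. -/
theorem exists_contract_eq (l : List (List α ⊕ List α)) : ∃ l' : List (List α ⊕ List α),
    contract (l.map (itemMonomial R)) = l'.map (itemMonomial R) ∧
      l'.flatMap itemWord = l.flatMap itemWord ∧ l'.IsChain fun c d => c.isLeft ≠ d.isLeft := by
  induction l with
  | nil => exact ⟨[], rfl, rfl, List.IsChain.nil⟩
  | cons c l ih =>
    obtain ⟨l', h1, h2, h3⟩ := ih
    rcases c with a | b <;> rcases l' with _ | ⟨a' | b', l''⟩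
    · exact ⟨[Sum.inl a], by simp [itemMonomial, contract] at h1 ⊢; rw [h1], by simp [← h2],
        List.IsChain.singleton _⟩
    · refine ⟨Sum.inl (a ++ a') :: l'', ?_, ?_, ?_⟩
      · simp [itemMonomial, contract] at h1 ⊢; rw [h1]; simp [monomial]
      · rw [List.flatMap_cons, List.flatMap_cons, ← h2]; simp [itemWord]
      · cases l'' <;> simp_all
    · exact ⟨Sum.inl a :: Sum.inr b' :: l'', by simp [itemMonomial, contract] at h1 ⊢; rw [h1],
        by simp [← h2], by simpa using h3⟩
    · exact ⟨[Sum.inr b], by simp [itemMonomial, contract] at h1 ⊢; rw [h1], by simp [← h2],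
        List.IsChain.singleton _⟩
    · exact ⟨Sum.inr b :: Sum.inl a' :: l'', by simp [itemMonomial, contract] at h1 ⊢; rw [h1],
        by simp [← h2], by simpa using h3⟩
    · refine ⟨Sum.inr (b ++ b') :: l'', ?_, ?_, ?_⟩
      · simp [itemMonomial, contract] at h1 ⊢; rw [h1]; simp [monomial]
      · rw [List.flatMap_cons, List.flatMap_cons, ← h2]; simp [itemWord]
      · cases l'' <;> simp_all

/-- A functional for which centered alternating products vanish is the free product of its
restrictions. -/
theorem freeValue_eq_of_centered {G : NCSeries (α ⊕ α) R} (hG0 : G [] = 1)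
    (hG : ∀ l : List (List α ⊕ List α), l ≠ [] → (l.IsChain fun c d => c.isLeft ≠ d.isLeft) →
      centered G l G = 0)
    (f g : FreeAlgebra R α →ₗ[R] R) (hf : ∀ a, f (monomial R a) = G (a.map Sum.inl))
    (hg : ∀ a, g (monomial R a) = G (a.map Sum.inr)) (l : List (List α ⊕ List α)) :
    freeValue f g (l.map (itemMonomial R)) = G (l.flatMap itemWord) := by
  classical
  induction hn : l.length using Nat.strong_induction_on generalizing l with
  | _ n ih =>
  obtain ⟨l', h1, h2, h3⟩ := exists_contract_eq (R := R) l
  have hlen : l'.length ≤ l.length := by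
    have := length_contract_le (l.map (itemMonomial R))
    rwa [h1, List.length_map, List.length_map] at this
  rw [freeValue]
  rw [← h2]
  generalize contract (l.map (itemMonomial R)) = k at h1 ⊢
  subst h1
  by_cases hl' : l' = []
  · subst hl'; simp [hG0]
  rw [if_neg (by simpa using hl')]
  have hφ : ∀ c, Sum.elim f g (itemMonomial R c) = G (itemWord c) := by
    rintro (a | b)
    · exact hf a
    · exact hg b
  have key := hG l' hl' h3
  -- The full set of positions contributes the value wanted; solving for it turns the other terms
  -- into the defining recursion, with the extra sign as the `+ 1` in the exponent.
  rw [centered_eq_sum, ← Finset.add_sum_erase _ _ (Finset.mem_univ Finset.univ),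
    sublistAt_univ] at key
  simp only [Finset.mem_univ, if_true, Finset.prod_const_one, mul_one] at key
  rw [eq_neg_of_add_eq_zero_left key, ← Finset.sum_neg_distrib]
  rw [← Finset.sum_subtype (s := Finset.univ.erase (Finset.univ)) (p := fun I => I ⊂ Finset.univ)
    (f := fun I => (-1) ^ ((l'.map (itemMonomial R)).length - I.card + 1) *
        freeValue f g (sublistAt (l'.map (itemMonomial R)) I) *
        ∏ i ∈ Iᶜ, Sum.elim f g ((l'.map (itemMonomial R)).get i))
    (fun I => by simp [Finset.ssubset_univ_iff])]
  symm
  refine Finset.sum_bij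
    (fun I _ => I.map (finCongr (List.length_map (as := l') (itemMonomial R)).symm).toEmbedding)
    ?_ ?_ ?_ ?_
  · intro I hI
    simp only [Finset.mem_erase, Finset.mem_univ, and_true] at hI ⊢
    intro h
    exact hI (Finset.eq_univ_of_card _ (by
      rw [← Finset.card_map, h, Finset.card_univ, Fintype.card_fin, Fintype.card_fin,
        List.length_map]))
  · intro I _ J _ h
    exact Finset.map_injective _ h
  · intro J hJ
    refine ⟨J.map (finCongr (List.length_map (as := l') (itemMonomial R))).toEmbedding, ?_, ?_⟩
    · simp only [Finset.mem_erase, Finset.mem_univ, and_true] at hJ ⊢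
      intro h
      exact hJ (Finset.eq_univ_of_card _ (by
        rw [← Finset.card_map, h, Finset.card_univ, Fintype.card_fin, Fintype.card_fin,
          List.length_map]))
    · rw [Finset.map_map]; ext; simp
  · intro I hI
    have hI' : I.card < l'.length := by
      have := Finset.card_lt_univ_of_notMem (s := I) (x := (Finset.nonempty_iff_ne_empty.2
        (by simpa using hI : Iᶜ ≠ ∅)).choose)
        (Finset.mem_compl.1 (Finset.nonempty_iff_ne_empty.2
        (by simpa using hI : Iᶜ ≠ ∅)).choose_spec)
      simpa using this
    rw [sublistAt_map, ih (sublistAt l' I).length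
      (by simp [sublistAt]; omega) _ rfl, Finset.card_map]
    have hp : ∏ i, (if i ∈ I then 1 else -G (itemWord (l'.get i))) =
        (-1) ^ (l'.length - I.card) * ∏ i ∈ Iᶜ, G (itemWord (l'.get i)) := by
      rw [← Finset.prod_mul_prod_compl I, Finset.prod_congr rfl fun i hi => if_pos hi,
        Finset.prod_congr (s₁ := Iᶜ) rfl fun i hi => if_neg (Finset.mem_compl.1 hi),
        Finset.prod_const_one, one_mul, Finset.prod_neg, Finset.card_compl, Fintype.card_fin]
    have hc : ∏ i ∈ (I.map (finCongr (List.length_map (as := l')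
          (itemMonomial R)).symm).toEmbedding)ᶜ,
        Sum.elim f g ((l'.map (itemMonomial R)).get i) = ∏ i ∈ Iᶜ, G (itemWord (l'.get i)) := by
      have : (I.map (finCongr (List.length_map (as := l')
          (itemMonomial R)).symm).toEmbedding)ᶜ =
          Iᶜ.map (finCongr (List.length_map (as := l') (itemMonomial R)).symm).toEmbedding := by
        ext; simp
      rw [this, Finset.prod_map]
      refine Finset.prod_congr rfl fun i _ => ?_
      rw [← hφ]
      simp
    rw [hp, hc, List.length_map, pow_succ]
    ring

end FreeConv

namespace FreeConv

/-! ### Non-crossing partitions of intervals of natural numbers -/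

/-- A non-crossing equivalence relation on `ℕ` that is trivial outside `[a, b)`. -/
structure IsNCRel (a b : ℕ) (r : ℕ → ℕ → Prop) : Prop where
  refl : ∀ i, r i i
  symm : ∀ i j, r i j → r j i
  trans : ∀ i j k, r i j → r j k → r i k
  support : ∀ i j, r i j → i ≠ j → a ≤ i ∧ i < b ∧ a ≤ j ∧ j < b
  nonCrossing : NonCrossingRel r

theorem finite_isNCRel (a b : ℕ) : {r | IsNCRel a b r}.Finite := by
  classical
  refine Set.Finite.subset (((Finset.Ico a b ×ˢ Finset.Ico a b).powerset.finite_toSet).image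
    fun S i j => i = j ∨ (i, j) ∈ S) fun r hr => ?_
  refine ⟨(Finset.Ico a b ×ˢ Finset.Ico a b).filter fun p => r p.1 p.2,
    Finset.mem_coe.2 (Finset.mem_powerset.2 (Finset.filter_subset _ _)), ?_⟩
  funext i j
  have h1 := hr.refl i
  have h2 := hr.support i j
  simp only [Finset.mem_filter, Finset.mem_product, Finset.mem_Ico, eq_iff_iff]
  grind

/-- The non-crossing equivalence relations on `[a, b)`. -/
noncomputable def ncRels (a b : ℕ) : Finset (ℕ → ℕ → Prop) := (finite_isNCRel a b).toFinset

theorem mem_ncRels {a b : ℕ} {r : ℕ → ℕ → Prop} : r ∈ ncRels a b ↔ IsNCRel a b r := by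
  simp [ncRels]

/-- The Kreweras complement of a relation. -/
def krew (r : ℕ → ℕ → Prop) (i j : ℕ) : Prop :=
  ∀ p q, r p q → (p ∈ Finset.Ioc (min i j) (max i j) ↔ q ∈ Finset.Ioc (min i j) (max i j))

theorem krew_symm {r : ℕ → ℕ → Prop} {i j : ℕ} (h : krew r i j) : krew r j i := fun p q hpq => by
  rw [min_comm, max_comm]; exact h p q hpq

theorem krew_comm {r : ℕ → ℕ → Prop} {i j : ℕ} : krew r i j ↔ krew r j i := ⟨krew_symm, krew_symm⟩

theorem krew_trans {r : ℕ → ℕ → Prop} {i j k : ℕ} (h₁ : krew r i j) (h₂ : krew r j k) :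
    krew r i k := fun p q hpq => by
  have e₁ := h₁ p q hpq
  have e₂ := h₂ p q hpq
  simp only [Finset.mem_Ioc] at *
  grind

theorem krew_iff_of_le {r : ℕ → ℕ → Prop} {i j : ℕ} (h : i ≤ j) :
    krew r i j ↔ ∀ p q, r p q → (i < p ∧ p ≤ j ↔ i < q ∧ q ≤ j) := by
  simp only [krew, min_eq_left h, max_eq_right h, Finset.mem_Ioc]

/-- The restriction of a relation to `[a, b)`. -/
def restrictRel (r : ℕ → ℕ → Prop) (a b i j : ℕ) : Prop :=
  i = j ∨ r i j ∧ a ≤ i ∧ i < b ∧ a ≤ j ∧ j < b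

/-- The union of a relation on `(a, c)` and a relation on `[c, ∞)`, with `a` added to the class
of `c`. -/
def glue (a c : ℕ) (r₁ r₂ : ℕ → ℕ → Prop) (i j : ℕ) : Prop :=
  r₁ i j ∨ r₂ (if i = a then c else i) (if j = a then c else j)

theorem IsNCRel.restrictRel {a b : ℕ} {r : ℕ → ℕ → Prop} (h : IsNCRel a b r) (c d : ℕ) :
    IsNCRel c d (restrictRel r c d) where
  refl i := Or.inl rfl
  symm i j hij := by have := h.symm i j; grind [FreeConv.restrictRel]
  trans i j k := by have := h.trans i j k; grind [FreeConv.restrictRel]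
  support i j := by grind [FreeConv.restrictRel]
  nonCrossing i j k l := by
    have := h.nonCrossing i j k l
    grind [FreeConv.restrictRel]

theorem IsNCRel.glue {a b c : ℕ} {r₁ r₂ : ℕ → ℕ → Prop} (hac : a < c) (hcb : c < b)
    (h₁ : IsNCRel (a + 1) c r₁) (h₂ : IsNCRel c b r₂) : IsNCRel a b (glue a c r₁ r₂) where
  refl i := Or.inl (h₁.refl i)
  symm i j hij := by
    have e1 := h₁.symm i j
    have e2 := h₂.symm (if i = a then c else i) (if j = a then c else j)
    grind [FreeConv.glue]
  trans i j k hij hjk := by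
    have e1 := h₁.trans i j k
    have e2 := h₂.trans (if i = a then c else i) (if j = a then c else j) (if k = a then c else k)
    have s1 := h₁.support i j
    have s2 := h₁.support j k
    have s3 := h₂.support (if i = a then c else i) (if j = a then c else j)
    have s4 := h₂.support (if j = a then c else j) (if k = a then c else k)
    unfold FreeConv.glue at *
    by_cases hij' : i = j
    · subst hij'; exact hjk
    by_cases hjk' : j = k
    · subst hjk'; exact hij
    grind
  support i j hij hne := by
    have s1 := h₁.support i j
    have s3 := h₂.support (if i = a then c else i) (if j = a then c else j)
    unfold FreeConv.glue at *
    grind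
  nonCrossing i j k l hij hjk hkl hik hjl := by
    have e1 := h₁.nonCrossing i j k l hij hjk hkl
    have e2 := h₂.nonCrossing (if i = a then c else i) j k l
    have s1 := h₁.support i k
    have s2 := h₁.support j l
    have s3 := h₂.support (if i = a then c else i) (if k = a then c else k)
    have s4 := h₂.support (if j = a then c else j) (if l = a then c else l)
    have t := h₂.refl c
    unfold FreeConv.glue at *
    grind

/-- The position `c` follows `a` in its class. -/
def IsNext (r : ℕ → ℕ → Prop) (a c : ℕ) : Prop := a < c ∧ r a c ∧ ∀ j, a < j → j < c → ¬r a j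

/-- As `a` and `c` are consecutive in their class, a class that meets the interval between them and
leaves it would cross this class. -/
theorem IsNCRel.lt_of_rel {a b c i j : ℕ} {r : ℕ → ℕ → Prop} (h : IsNCRel a b r)
    (hc : IsNext r a c) (hi : a < i) (hi' : i < c) (hij : r i j) : a < j ∧ j < c := by
  obtain ⟨h1, h2, h3⟩ := hc
  have e1 := h3 i hi hi'
  have e2 := h.nonCrossing a i c j
  have e3 := h.support i j hij
  have e4 := h.symm i j hij
  have e5 : j ≠ c := fun e => e1 (h.trans _ _ _ h2 (e ▸ e4))
  grind

theorem glue_restrictRel {a b c : ℕ} {r : ℕ → ℕ → Prop} (h : IsNCRel a b r)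
    (hc : IsNext r a c) (hcb : c < b) :
    glue a c (restrictRel r (a + 1) c) (restrictRel r c b) = r := by
  funext i j
  rw [eq_iff_iff]
  have hc' := hc
  obtain ⟨h1, h2, h3⟩ := hc'
  have a1 := fun hi hi' hij => h.lt_of_rel (i := i) (j := j) hc hi hi' hij
  have a2 := fun hi hi' hij => h.lt_of_rel (i := j) (j := i) hc hi hi' hij
  have b1 := h.support i j
  have b2 := h.refl i
  have b3 := h.symm i j
  have b4 := h.trans a c j h2
  have b5 := h.symm a c h2
  have b6 := h.trans c a j b5
  have b7 := h.trans i a c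
  have b8 := h.trans i c a
  unfold glue restrictRel
  grind

theorem restrictRel_glue_left {a b c : ℕ} {r₁ r₂ : ℕ → ℕ → Prop}
    (h₁ : IsNCRel (a + 1) c r₁) (h₂ : IsNCRel c b r₂) :
    restrictRel (glue a c r₁ r₂) (a + 1) c = r₁ := by
  funext i j
  rw [eq_iff_iff]
  have e1 := h₁.refl i
  have e2 := h₁.support i j
  have e3 := h₂.support i j
  unfold glue restrictRel
  grind

theorem restrictRel_glue_right {a b c : ℕ} {r₁ r₂ : ℕ → ℕ → Prop} (hac : a < c)
    (h₁ : IsNCRel (a + 1) c r₁) (h₂ : IsNCRel c b r₂) :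
    restrictRel (glue a c r₁ r₂) c b = r₂ := by
  funext i j
  rw [eq_iff_iff]
  have e1 := h₂.refl i
  have e2 := h₁.support i j
  have e3 := h₂.support i j
  unfold glue restrictRel
  grind

theorem isNext_glue {a b c : ℕ} {r₁ r₂ : ℕ → ℕ → Prop} (hac : a < c)
    (h₁ : IsNCRel (a + 1) c r₁) (h₂ : IsNCRel c b r₂) : IsNext (glue a c r₁ r₂) a c := by
  refine ⟨hac, Or.inr (by simpa [hac.ne'] using h₂.refl c), fun j hj hj' => ?_⟩
  have e2 := h₁.support a j
  have e3 := h₂.support c j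
  unfold glue
  grind

/-- Every relation on `[a, b)` either isolates `a` or has a position that follows `a`. -/
theorem sum_ncRels {M : Type*} [AddCommMonoid M] {a b : ℕ} (F : (ℕ → ℕ → Prop) → M) :
    ∑ r ∈ ncRels a b, F r = ∑ r ∈ ncRels (a + 1) b, F r +
      ∑ c ∈ Finset.Ioo a b, ∑ p ∈ ncRels (a + 1) c ×ˢ ncRels c b, F (glue a c p.1 p.2) := by
  classical
  have hdis : (ncRels a b).filter (fun r => ∀ j, r a j → j = a) = ncRels (a + 1) b := by
    ext r
    simp only [Finset.mem_filter, mem_ncRels]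
    constructor
    · rintro ⟨h, ha⟩
      refine ⟨h.refl, h.symm, h.trans, fun i j hij hne => ?_, h.nonCrossing⟩
      have e1 := h.support i j hij hne
      have e2 := ha j
      have e3 := ha i
      have e4 := h.symm i j hij
      grind
    · intro h
      refine ⟨⟨h.refl, h.symm, h.trans, fun i j hij hne => ?_, h.nonCrossing⟩, fun j hj => ?_⟩
      · have e1 := h.support i j hij hne
        omega
      · have := h.support a j hj
        grind
  rw [← Finset.sum_filter_add_sum_filter_not _ (fun r => ∀ j, r a j → j = a), hdis]
  congr 1
  rw [Finset.sum_sigma']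
  symm
  refine Finset.sum_bij' (fun q _ => glue a q.1 q.2.1 q.2.2)
    -- The second alternative is a dummy: on the filtered set some position follows `a`. The least
    -- one is the splitting point.
    (fun r _ => if h : ∃ j, a < j ∧ r a j then
      ⟨Nat.find h, restrictRel r (a + 1) (Nat.find h), restrictRel r (Nat.find h) b⟩ else
      ⟨0, r, r⟩) ?_ ?_ ?_ ?_ ?_
  · rintro ⟨c, r₁, r₂⟩ hq
    simp only [Finset.mem_sigma, Finset.mem_Ioo, Finset.mem_product, mem_ncRels] at hq
    simp only [Finset.mem_filter, mem_ncRels]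
    refine ⟨IsNCRel.glue hq.1.1 hq.1.2 hq.2.1 hq.2.2, fun h => ?_⟩
    have := isNext_glue hq.1.1 hq.2.1 hq.2.2
    have := h _ this.2.1
    omega
  · intro r hr
    simp only [Finset.mem_filter, mem_ncRels] at hr
    have hex : ∃ j, a < j ∧ r a j := by
      by_contra hcon
      refine hr.2 fun j hj => ?_
      by_contra hne
      have := hr.1.support a j hj (Ne.symm hne)
      exact hcon ⟨j, by omega, hj⟩
    rw [dif_pos hex]
    have h1 := Nat.find_spec hex
    have h2 := hr.1.support a _ h1.2 (by omega)
    simp only [Finset.mem_sigma, Finset.mem_Ioo, Finset.mem_product, mem_ncRels]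
    exact ⟨⟨h1.1, h2.2.2.2⟩, hr.1.restrictRel _ _, hr.1.restrictRel _ _⟩
  · rintro ⟨c, r₁, r₂⟩ hq
    simp only [Finset.mem_sigma, Finset.mem_Ioo, Finset.mem_product, mem_ncRels] at hq
    have hn := isNext_glue hq.1.1 hq.2.1 hq.2.2
    have hex : ∃ j, a < j ∧ glue a c r₁ r₂ a j := ⟨c, hn.1, hn.2.1⟩
    have hf : Nat.find hex = c := (Nat.find_eq_iff hex).2 ⟨⟨hn.1, hn.2.1⟩, fun j hj hj' =>
      hn.2.2 j hj'.1 hj hj'.2⟩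
    rw [dif_pos hex, hf, restrictRel_glue_left hq.2.1 hq.2.2,
      restrictRel_glue_right hq.1.1 hq.2.1 hq.2.2]
  · intro r hr
    simp only [Finset.mem_filter, mem_ncRels] at hr
    have hex : ∃ j, a < j ∧ r a j := by
      by_contra hcon
      refine hr.2 fun j hj => ?_
      by_contra hne
      have := hr.1.support a j hj (Ne.symm hne)
      exact hcon ⟨j, by omega, hj⟩
    have h1 := Nat.find_spec hex
    have h2 := hr.1.support a _ h1.2 (by omega)
    simp only [dif_pos hex]
    exact glue_restrictRel hr.1 ⟨h1.1, h1.2, fun j hj hj' hr => Nat.find_min hex hj' ⟨hj, hr⟩⟩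
      h2.2.2.2
  · intro q _
    rfl

end FreeConv

/-! ### Weights of non-crossing relations and their recursion -/

namespace FreeConv

open NCSeries

section Weights

variable {α R : Type*} [CommRing R]

open Classical in
/-- The word of the letters `x i` with `i ∈ [a, b)` and `P i`. -/
noncomputable def subword (x : ℕ → α) (P : ℕ → Prop) (a b : ℕ) : List α :=
  ((List.Ico a b).filter fun i => P i).map x

theorem subword_congr {x : ℕ → α} {P Q : ℕ → Prop} {a b : ℕ}
    (h : ∀ i, a ≤ i → i < b → (P i ↔ Q i)) : subword x P a b = subword x Q a b := by
  unfold subword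
  congr 1
  refine List.filter_congr fun i hi => ?_
  rw [List.Ico.mem] at hi
  simp [h i hi.1 hi.2]

theorem subword_append (x : ℕ → α) (P : ℕ → Prop) {a b c : ℕ} (hac : a ≤ c) (hcb : c ≤ b) :
    subword x P a b = subword x P a c ++ subword x P c b := by
  unfold subword
  rw [← List.Ico.append_consecutive hac hcb, List.filter_append, List.map_append]

theorem subword_cons (x : ℕ → α) {P : ℕ → Prop} {a b : ℕ} (hab : a < b) (hP : P a) :
    subword x P a b = x a :: subword x P (a + 1) b := by
  unfold subword
  rw [List.Ico.eq_cons hab, List.filter_cons_of_pos (by simpa using hP), List.map_cons]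

theorem subword_cons_neg (x : ℕ → α) {P : ℕ → Prop} {a b : ℕ} (hab : a < b) (hP : ¬P a) :
    subword x P a b = subword x P (a + 1) b := by
  unfold subword
  rw [List.Ico.eq_cons hab, List.filter_cons_of_neg (by simpa using hP)]

theorem subword_eq_nil {x : ℕ → α} {P : ℕ → Prop} {a b : ℕ}
    (h : ∀ i, a ≤ i → i < b → ¬P i) : subword x P a b = [] := by
  unfold subword
  rw [List.map_eq_nil_iff, List.filter_eq_nil_iff]
  intro i hi
  rw [List.Ico.mem] at hi
  simpa using h i hi.1 hi.2

/-- The factor at position `i` of a product over classes, taken at the least elements. -/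
noncomputable def minFactor (f : NCSeries α R) (x : ℕ → α) (r : ℕ → ℕ → Prop) (a b i : ℕ) : R :=
  open Classical in if ∀ j, r i j → i ≤ j then f (subword x (r i) a b) else 1

/-- The factor at position `i` of a product over classes of the Kreweras complement, taken at the
greatest elements. -/
noncomputable def maxFactor (g : NCSeries α R) (x : ℕ → α) (r : ℕ → ℕ → Prop) (a b i : ℕ) : R :=
  -- The bound `j < b` matters: a relation on `[a, b)` is trivial beyond `b`, so its complement
  -- relates `b - 1` to all later positions.
  open Classical in if ∀ j, i < j → j < b → ¬krew r i j then g (subword x (krew r i) a b) else 1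

/-- The product over the classes of `r`, with `u` in front of the class of `a`. -/
noncomputable def weightL (f : NCSeries α R) (x : ℕ → α) (r : ℕ → ℕ → Prop) (a b : ℕ)
    (u : List α) : R :=
  f (u ++ subword x (r a) a b) * ∏ i ∈ Finset.Ico (a + 1) b, minFactor f x r a b i

/-- The product over the classes of the Kreweras complement of `r`, with `v` in front of the class
of `b - 1`. -/
noncomputable def weightR (g : NCSeries α R) (x : ℕ → α) (r : ℕ → ℕ → Prop) (a b : ℕ)
    (v : List α) : R :=
  g (v ++ subword x (krew r (b - 1)) a b) * ∏ i ∈ Finset.Ico a (b - 1), maxFactor g x r a b i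

variable (f g : NCSeries α R) (x : ℕ → α) {a b c : ℕ} {r : ℕ → ℕ → Prop}

theorem weightL_of_le (hba : b ≤ a) (u : List α) : weightL f x r a b u = f u := by
  rw [weightL, subword_eq_nil (by omega), Finset.Ico_eq_empty (by omega)]; simp

theorem weightR_of_le (hba : b ≤ a) (v : List α) : weightR g x r a b v = g v := by
  rw [weightR, subword_eq_nil (by omega), Finset.Ico_eq_empty (by omega)]; simp

theorem weightL_nil (hf : f [] = 1) (hr : IsNCRel a b r) :
    weightL f x r a b [] = ∏ i ∈ Finset.Ico a b, minFactor f x r a b i := by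
  rcases le_or_gt b a with hab | hab
  · rw [weightL, subword_eq_nil (by omega), Finset.Ico_eq_empty (by omega),
      Finset.Ico_eq_empty (by omega)]
    simp [hf]
  · rw [Finset.prod_eq_prod_Ico_succ_bot hab, weightL, List.nil_append]
    congr 1
    rw [minFactor, if_pos]
    intro j hj
    have := hr.support a j hj
    grind

theorem weightR_nil (hab : a < b) :
    weightR g x r a b [] = ∏ i ∈ Finset.Ico a b, maxFactor g x r a b i := by
  obtain ⟨b, rfl⟩ : ∃ b', b = b' + 1 := ⟨b - 1, by omega⟩
  rw [Finset.prod_Ico_succ_top (by omega), weightR, List.nil_append, mul_comm, Nat.add_sub_cancel]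
  congr 1
  rw [maxFactor, if_pos]
  intro j _ _; omega

theorem weightL_of_isolated (hf : f [] = 1) (hab : a < b) (hr : IsNCRel (a + 1) b r)
    (u : List α) : weightL f x r a b u = f (u ++ [x a]) * weightL f x r (a + 1) b [] := by
  have h1 : ∀ j, r a j → j = a := fun j hj => by
    have := hr.support a j hj; grind
  rw [weightL_nil f x hf hr, weightL, subword_cons x hab (hr.refl a),
    subword_eq_nil fun i hi _ h => by have := h1 i h; omega]
  congr 1
  refine Finset.prod_congr rfl fun i hi => ?_
  rw [Finset.mem_Ico] at hi
  rw [minFactor, minFactor, subword_cons_neg x hab fun h => by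
    have := h1 i (hr.symm _ _ h); omega]

/-- All non-trivial classes lie in `(a, b - 1]`, so the complement joins `a` to `b - 1`; the letter
of `a` becomes the first one of the marked class. -/
theorem weightR_of_isolated (hab : a < b) (hr : IsNCRel (a + 1) b r) (v : List α) :
    weightR g x r a b v = weightR g x r (a + 1) b (v ++ [x a]) := by
  have hk : krew r a (b - 1) := by
    rw [krew_iff_of_le (by omega)]
    intro p q hpq
    have := hr.support p q hpq
    grind
  rw [weightR, weightR, subword_cons x hab (krew_symm hk), List.append_assoc, List.singleton_append]
  congr 1
  rcases Nat.lt_or_ge a (b - 1) with h | h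
  · rw [Finset.prod_eq_prod_Ico_succ_bot h, maxFactor, if_neg, one_mul]
    · refine Finset.prod_congr rfl fun i hi => ?_
      rw [Finset.mem_Ico] at hi
      unfold maxFactor
      split_ifs with hm
      · rw [subword_cons_neg x hab fun h => hm (b - 1) (by omega) (by omega) (krew_trans h hk)]
      · rfl
    · exact fun h' => h' (b - 1) h (by omega) hk
  · rw [Finset.Ico_eq_empty (by omega), Finset.Ico_eq_empty (by omega), Finset.prod_empty,
      Finset.prod_empty]

theorem weightL_of_isNext (hf : f [] = 1) (hr : IsNCRel a b r) (hc : IsNext r a c) (hcb : c < b)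
    (u : List α) : weightL f x r a b u = weightL f x (restrictRel r (a + 1) c) (a + 1) c [] *
      weightL f x (restrictRel r c b) c b (u ++ [x a]) := by
  have hac := hc.1
  have hin : ∀ i j, a < i → i < c → r i j → a < j ∧ j < c := fun i j h1 h2 h3 =>
    hr.lt_of_rel hc h1 h2 h3
  -- In `r` the position `c` is not least in its class and has factor `1`. After restriction to `[c,
  -- b)` its class is the marked one, with the letter of `a` put at the end of the word in front.
  rw [weightL_nil f x hf (hr.restrictRel _ _), weightL, weightL, subword_cons x (by omega)
    (hr.refl a), subword_append x _ (c := c) (by omega) hcb.le,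
    subword_eq_nil (a := a + 1) fun i h1 h2 => hc.2.2 i h1 h2, List.nil_append,
    ← Finset.prod_Ico_consecutive _ (show a + 1 ≤ c from hac) hcb.le,
    Finset.prod_eq_prod_Ico_succ_bot hcb, minFactor, if_neg, one_mul, List.append_assoc,
    List.singleton_append, subword_congr (Q := restrictRel r c b c)]
  · rw [mul_left_comm]
    congr 1
    · refine Finset.prod_congr rfl fun i hi => ?_
      rw [Finset.mem_Ico] at hi
      have h1 : ∀ j, r i j ↔ restrictRel r (a + 1) c i j := fun j => by
        have := hin i j (by omega) (by omega)
        have := hr.refl i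
        unfold restrictRel
        grind
      unfold minFactor
      rw [subword_append x _ (show a ≤ a + 1 by omega) (by omega),
        subword_append x _ (show a + 1 ≤ c by omega) hcb.le, subword_eq_nil, List.nil_append,
        subword_eq_nil (a := c), List.append_nil, subword_congr fun j _ _ => h1 j]
      · classical exact if_congr (forall_congr' fun j => by rw [h1]) rfl rfl
      · intro j h2 h3 h4
        have := hin i j (by omega) (by omega) h4
        omega
      · intro j h2 h3 h4
        have := hin i j (by omega) (by omega) h4
        omega
    · congr 1
      refine Finset.prod_congr rfl fun i hi => ?_
      rw [Finset.mem_Ico] at hi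
      have h1 : ∀ j, c ≤ j → (r i j ↔ restrictRel r c b i j) := fun j hj => by
        have := hr.support i j
        have := hr.refl i
        unfold restrictRel
        grind
      have h2 : (∀ j, r i j → i ≤ j) ↔ ∀ j, restrictRel r c b i j → i ≤ j := by
        constructor
        · intro h j hj
          unfold restrictRel at hj
          have := h j
          grind
        · intro h j hj
          by_contra hlt
          have e1 := hr.support i j hj (by omega)
          rcases Nat.lt_or_ge j c with hjc | hjc
          · have e2 : j = a := by
              by_contra hne
              have := hin j i (by omega) hjc (hr.symm _ _ hj)
              omega
            subst e2
            have := h c ((h1 c le_rfl).1 (hr.trans _ _ _ hj hc.2.1))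
            omega
          · have := h j ((h1 j hjc).1 hj)
            omega
      unfold minFactor
      split_ifs with h3 h4 h4
      · rw [subword_append x _ (show a ≤ c by omega) hcb.le, subword_eq_nil, List.nil_append,
          subword_congr fun j h5 _ => h1 j h5]
        intro j _ h5 h6
        have := h3 j h6
        omega
      · exact absurd (h2.1 h3) h4
      · exact absurd (h2.2 h4) h3
      · rfl
  · intro i h1 h2
    have e1 := hr.trans a c i hc.2.1
    have e2 := hr.trans c a i (hr.symm _ _ hc.2.1)
    have e3 := hr.refl c
    unfold restrictRel
    grind
  · exact fun h => by have := h a (hr.symm _ _ hc.2.1); omega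

theorem krew_restrictRel_left {i j : ℕ} (hr : IsNCRel a b r) (hc : IsNext r a c)
    (hi : a ≤ i) (hi' : i < c) (hj : a ≤ j) (hj' : j < c) :
    krew r i j ↔ krew (restrictRel r (a + 1) c) i j := by
  wlog hij : i ≤ j generalizing i j
  · rw [krew_comm, this hj hj' hi hi' (by omega), krew_comm]
  rw [krew_iff_of_le hij, krew_iff_of_le hij]
  refine forall_congr' fun p => forall_congr' fun q => ?_
  have := fun h1 h2 h3 => hr.lt_of_rel (i := p) (j := q) hc h1 h2 h3
  have := fun h1 h2 h3 => hr.lt_of_rel (i := q) (j := p) hc h1 h2 h3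
  have := hr.symm p q
  have := hr.refl p
  unfold restrictRel
  grind

/-- The only outside position linked to `[c, b)` is `a`. It may be replaced by `c`, which is in the
same class and also lies outside `(i, j]`. -/
theorem krew_restrictRel_right {i j : ℕ} (hr : IsNCRel a b r) (hc : IsNext r a c)
    (hi : c ≤ i) (hi' : i < b) (hj : c ≤ j) (hj' : j < b) :
    krew r i j ↔ krew (restrictRel r c b) i j := by
  wlog hij : i ≤ j generalizing i j
  · rw [krew_comm, this hj hj' hi hi' (by omega), krew_comm]
  rw [krew_iff_of_le hij, krew_iff_of_le hij]
  constructor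
  · intro h p q hpq
    rcases hpq with rfl | hpq
    · rfl
    · exact h p q hpq.1
  · intro h
    have key : ∀ p q, r p q → i < p ∧ p ≤ j → i < q ∧ q ≤ j := by
      intro p q hpq hp
      have s := hr.support p q hpq
      by_cases hpq' : p = q
      · subst hpq'; exact hp
      rcases Nat.lt_or_ge q c with hq | hq
      · exfalso
        have e2 : q = a := by
          by_contra hne
          have := hr.lt_of_rel hc (by omega) hq (hr.symm _ _ hpq)
          omega
        subst e2
        have := (h p c (Or.inr ⟨hr.trans _ _ _ hpq hc.2.1, by omega⟩)).1 hp
        omega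
      · exact (h p q (Or.inr ⟨hpq, by omega⟩)).1 hp
    exact fun p q hpq => ⟨key p q hpq, key q p (hr.symm _ _ hpq)⟩

theorem not_krew_of_isNext {i j : ℕ} (hc : IsNext r a c) (hi : a ≤ i) (hi' : i < c) (hj : c ≤ j) :
    ¬krew r i j := by
  rw [krew_iff_of_le (by omega)]
  intro h
  have := h a c hc.2.1
  omega

/-- The complement has no class meeting both `[a, c)` and `[c, b)`, since the link between `a` and
`c` separates them. On `[a, c)` the restricted relation isolates `a`, whence the word `[x a]`. -/
theorem weightR_of_isNext (hr : IsNCRel a b r) (hc : IsNext r a c) (hcb : c < b)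
    (v : List α) : weightR g x r a b v = weightR g x (restrictRel r (a + 1) c) (a + 1) c [x a] *
      weightR g x (restrictRel r c b) c b v := by
  have hac := hc.1
  have h0 := weightR_of_isolated g x hac (hr.restrictRel (a + 1) c) []
  rw [List.nil_append] at h0
  rw [← h0, weightR_nil g x hac, weightR, weightR, subword_append x _ hac.le hcb.le,
    subword_eq_nil fun i h1 h2 h3 => not_krew_of_isNext hc h1 h2 (by omega) (krew_symm h3),
    List.nil_append, ← Finset.prod_Ico_consecutive _ hac.le (show c ≤ b - 1 by omega),
    mul_left_comm, subword_congr fun i h1 h2 =>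
      krew_restrictRel_right hr hc (i := b - 1) (j := i) (by omega) (by omega) h1 h2]
  congr 1
  · refine Finset.prod_congr rfl fun i hi => ?_
    rw [Finset.mem_Ico] at hi
    have h2 : (∀ j, i < j → j < b → ¬krew r i j) ↔
        ∀ j, i < j → j < c → ¬krew (restrictRel r (a + 1) c) i j := by
      refine forall_congr' fun j => ?_
      rcases Nat.lt_or_ge j c with hj | hj
      · have := fun h => krew_restrictRel_left (i := i) (j := j) hr hc hi.1 hi.2 h hj
        grind
      · have := not_krew_of_isNext hc hi.1 hi.2 hj
        grind
    rw [maxFactor, maxFactor, subword_append x _ hac.le hcb.le, subword_eq_nil (a := c) fun j h1 _ =>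
      not_krew_of_isNext hc hi.1 hi.2 h1, List.append_nil, subword_congr fun j h3 h4 =>
      krew_restrictRel_left hr hc hi.1 hi.2 h3 h4]
    classical exact if_congr h2 rfl rfl
  · congr 1
    refine Finset.prod_congr rfl fun i hi => ?_
    rw [Finset.mem_Ico] at hi
    have h2 : (∀ j, i < j → j < b → ¬krew r i j) ↔
        ∀ j, i < j → j < b → ¬krew (restrictRel r c b) i j := by
      refine forall_congr' fun j => ?_
      have := fun h h' => krew_restrictRel_right (i := i) (j := j) hr hc hi.1 (by omega) h h'
      grind
    rw [maxFactor, maxFactor, subword_append x _ hac.le hcb.le, subword_eq_nil fun j h3 h4 h5 =>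
      not_krew_of_isNext hc h3 h4 hi.1 (krew_symm h5), List.nil_append, subword_congr fun j h3 h4 =>
      krew_restrictRel_right hr hc hi.1 (by omega) h3 h4]
    classical exact if_congr h2 rfl rfl

/-- The sum of the weights of the non-crossing partitions of `[a, b)`. -/
noncomputable def ncSum (a b : ℕ) (u v : List α) : R :=
  ∑ r ∈ ncRels a b, weightL f x r a b u * weightR g x r a b v

theorem ncSum_of_le (hba : b ≤ a) (u v : List α) : ncSum f g x a b u v = f u * g v := by
  have h : ncRels a b = {Eq} := by
    ext r
    rw [mem_ncRels, Finset.mem_singleton]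
    constructor
    · intro h
      funext i j
      rw [eq_iff_iff]
      have := h.support i j
      have := h.refl i
      grind
    · rintro rfl
      exact ⟨fun _ => rfl, fun _ _ => Eq.symm, fun _ _ _ => Eq.trans, fun _ _ h h' => absurd h h',
        fun i j k l h1 h2 _ h3 _ => by omega⟩
  rw [ncSum, h, Finset.sum_singleton, weightL_of_le f x hba, weightR_of_le g x hba]

theorem ncSum_of_lt (hf : f [] = 1) (hab : a < b) (u v : List α) :
    ncSum f g x a b u v = f (u ++ [x a]) * ncSum f g x (a + 1) b [] (v ++ [x a]) +
      ∑ c ∈ Finset.Ioo a b, ncSum f g x (a + 1) c [] [x a] * ncSum f g x c b (u ++ [x a]) v := by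
  rw [ncSum, sum_ncRels]
  congr 1
  · rw [ncSum, Finset.mul_sum]
    refine Finset.sum_congr rfl fun r hr => ?_
    rw [mem_ncRels] at hr
    rw [weightL_of_isolated f x hf hab hr, weightR_of_isolated g x hab hr, mul_assoc]
  · refine Finset.sum_congr rfl fun c hc => ?_
    rw [Finset.mem_Ioo] at hc
    rw [ncSum, ncSum, Finset.sum_mul_sum, Finset.sum_product]
    refine Finset.sum_congr rfl fun r₁ h₁ => Finset.sum_congr rfl fun r₂ h₂ => ?_
    rw [mem_ncRels] at h₁ h₂
    have hg := IsNCRel.glue hc.1 hc.2 h₁ h₂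
    have hn := isNext_glue hc.1 h₁ h₂
    rw [weightL_of_isNext f x hf hg hn hc.2, weightR_of_isNext g x hg hn hc.2,
      restrictRel_glue_left h₁ h₂, restrictRel_glue_right hc.1 h₁ h₂]
    ring

theorem ncSum_eq_ncRec (hf : f [] = 1) (a b : ℕ) (u v : List α) :
    ncSum f g x a b u v = ncRec f g u v ((List.Ico a b).map x) := by
  induction hn : b - a using Nat.strong_induction_on generalizing a b u v with
  | _ n ih =>
  rcases Nat.lt_or_ge a b with hab | hab
  · rw [ncSum_of_lt f g x hf hab, List.Ico.eq_cons hab, List.map_cons, ncRec,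
      ih (b - (a + 1)) (by omega) (a + 1) b _ _ rfl]
    congr 1
    have hlen : ((List.Ico (a + 1) b).map x).length = b - (a + 1) := by simp
    symm
    refine Finset.sum_bij (fun k _ => a + 1 + k.1) ?_ ?_ ?_ ?_
    · intro k _; have := k.2; rw [Finset.mem_Ioo]; omega
    · intro k _ l _ h; exact Fin.ext (by omega)
    · intro c hc
      rw [Finset.mem_Ioo] at hc
      exact ⟨⟨c - (a + 1), by omega⟩, Finset.mem_univ _, by simp; omega⟩
    · intro k _
      have hk := k.2
      have h1 : (List.Ico (a + 1) b).map x =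
          (List.Ico (a + 1) (a + 1 + k)).map x ++ (List.Ico (a + 1 + k) b).map x := by
        rw [← List.map_append, List.Ico.append_consecutive (by omega) (by omega)]
      have h2 : ((List.Ico (a + 1) (a + 1 + k)).map x).length = k := by simp
      rw [ih _ (by omega) (a + 1) (a + 1 + k) _ _ rfl, ih _ (by omega) (a + 1 + k) b _ _ rfl]
      congr 2
      · exact (congrArg (List.take k) h1).trans (List.take_left' h2)
      · exact (congrArg (List.drop k) h1).trans (List.drop_left' h2)
  · rw [ncSum_of_le f g x hab, List.Ico.eq_nil_of_le hab, List.map_nil, ncRec]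

end Weights

end FreeConv

/-! ### Series without constant term as series with constant term one -/

namespace FreeConv

open NCSeries

/-- A series without constant term, with constant term `1` added. -/
def unital {s : ℕ} {R : Type*} [CommRing R] (f : Series s R) : NCSeries (Fin s) R :=
  fun w => if h : w = [] then 1 else f ⟨w, h⟩

variable {s : ℕ} {R : Type*} [CommRing R]

theorem unital_nil (f : Series s R) : unital f [] = 1 := rfl

theorem unital_coe (f : Series s R) (w : Word s) : unital f w.1 = f w := by
  rw [unital, dif_neg w.2]

theorem unital_injective : Function.Injective (unital : Series s R → NCSeries (Fin s) R) :=
  fun f g h => funext fun w => by rw [← unital_coe f, h, unital_coe]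

theorem exists_unital_eq (F : NCSeries (Fin s) R) (hF : F [] = 1) : ∃ f : Series s R, unital f = F :=
  ⟨fun w => F w.1, NCSeries.ext fun w => by
    by_cases h : w = []
    · subst h; exact hF.symm
    · rw [unital, dif_neg h]⟩

theorem unital_zeta : unital (zeta s R) = ones (Fin s) R :=
  NCSeries.ext fun w => by by_cases h : w = [] <;> simp [unital, zeta, ones]

theorem unital_boxOne : unital (boxOne s R) = 1 + sumX (Fin s) R := by
  ext w
  rcases w with _ | ⟨i, w⟩
  · exact one_add_sumX_nil.symm
  · rw [cons_apply (1 + sumX _ _), D_one_add_sumX]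
    cases w <;> simp [unital, boxOne, ← C_one, C]

/-! ### The boxed convolution as a sum over relations -/

section Finpartition

variable {n : ℕ} (π : Finpartition (Finset.univ : Finset (Fin n)))

theorem sameBlock_refl (i : Fin n) : SameBlock π i i :=
  ⟨π.part i, π.part_mem.2 (Finset.mem_univ i), π.mem_part (Finset.mem_univ i),
    π.mem_part (Finset.mem_univ i)⟩

theorem SameBlock.symm {π : Finpartition (Finset.univ : Finset (Fin n))} {i j : Fin n}
    (h : SameBlock π i j) : SameBlock π j i := by
  obtain ⟨V, hV, hi, hj⟩ := h
  exact ⟨V, hV, hj, hi⟩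

theorem sameBlock_iff_of_mem {π : Finpartition (Finset.univ : Finset (Fin n))}
    {V : Finset (Fin n)} (hV : V ∈ π.parts) {i j : Fin n} (hi : i ∈ V) :
    SameBlock π i j ↔ j ∈ V := by
  refine ⟨fun ⟨W, hW, hi', hj⟩ => ?_, fun hj => ⟨V, hV, hi, hj⟩⟩
  rwa [π.eq_of_mem_parts hV hW hi hi']

theorem SameBlock.trans {π : Finpartition (Finset.univ : Finset (Fin n))} {i j k : Fin n}
    (h : SameBlock π i j) (h' : SameBlock π j k) : SameBlock π i k := by
  obtain ⟨V, hV, hi, hj⟩ := h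
  exact ⟨V, hV, hi, (sameBlock_iff_of_mem hV hj).1 h'⟩

theorem le_of_sameBlock {π σ : Finpartition (Finset.univ : Finset (Fin n))}
    (h : ∀ i j, SameBlock π i j → SameBlock σ i j) : π ≤ σ := by
  intro V hV
  obtain ⟨i, hi⟩ := π.nonempty_of_mem_parts hV
  refine ⟨σ.part i, σ.part_mem.2 (Finset.mem_univ i), fun j hj => ?_⟩
  exact (sameBlock_iff_of_mem (σ.part_mem.2 (Finset.mem_univ i))
    (σ.mem_part (Finset.mem_univ i))).1 (h i j ⟨V, hV, hi, hj⟩)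

open Classical in
theorem sameBlock_ofSetoid (t : Setoid (Fin n)) (i j : Fin n) :
    SameBlock (Finpartition.ofSetoid t) i j ↔ t i j := by
  rw [sameBlock_iff_of_mem ((Finpartition.part_mem _).2 (Finset.mem_univ i))
    (Finpartition.mem_part _ (Finset.mem_univ i))]
  exact Finpartition.mem_part_ofSetoid_iff_rel

/-- The relation on `ℕ` of lying in the same block of `π`. -/
def natRel (i j : ℕ) : Prop := i = j ∨ ∃ (hi : i < n) (hj : j < n), SameBlock π ⟨i, hi⟩ ⟨j, hj⟩

theorem natRel_coe (i j : Fin n) : natRel π i j ↔ SameBlock π i j := by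
  refine ⟨?_, fun h => Or.inr ⟨i.2, j.2, h⟩⟩
  rintro (h | ⟨_, _, h⟩)
  · rw [Fin.ext h]; exact sameBlock_refl π j
  · exact h

theorem isNCRel_natRel (hπ : NonCrossingRel (SameBlock π)) : IsNCRel 0 n (natRel π) where
  refl i := Or.inl rfl
  symm i j := by
    rintro (h | ⟨hi, hj, h⟩)
    · exact Or.inl h.symm
    · exact Or.inr ⟨hj, hi, h.symm⟩
  trans i j k := by
    rintro (rfl | ⟨hi, hj, h⟩) (rfl | ⟨hi', hj', h'⟩)
    · exact Or.inl rfl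
    · exact Or.inr ⟨hi', hj', h'⟩
    · exact Or.inr ⟨hi, hj, h⟩
    · exact Or.inr ⟨hi, hj', h.trans h'⟩
  support i j := by
    rintro (rfl | ⟨hi, hj, h⟩) hne
    · exact absurd rfl hne
    · omega
  nonCrossing i j k l hij hjk hkl := by
    rintro (rfl | ⟨hi, hk, h⟩) (rfl | ⟨hj, hl, h'⟩)
    · omega
    · omega
    · omega
    · exact Or.inr ⟨hi, hj, hπ ⟨i, hi⟩ ⟨j, hj⟩ ⟨k, hk⟩ ⟨l, hl⟩ hij hjk hkl h h'⟩

theorem sameBlock_kreweras_iff (i j : Fin n) :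
    SameBlock (kreweras π) i j ↔ krew (natRel π) i j := by
  rw [sameBlock_kreweras]
  have hm : ∀ a : Fin n, a ∈ Finset.Ioc (min i j) (max i j) ↔
      (a : ℕ) ∈ Finset.Ioc (min (i : ℕ) j) (max (i : ℕ) j) := by
    intro a
    simp only [Finset.mem_Ioc, Fin.lt_def, Fin.le_def]
    rcases le_total i j with h | h
    · rw [min_eq_left h, max_eq_right h, min_eq_left (Fin.le_def.1 h), max_eq_right (Fin.le_def.1 h)]
    · rw [min_eq_right h, max_eq_left h, min_eq_right (Fin.le_def.1 h), max_eq_left (Fin.le_def.1 h)]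
  constructor
  · rintro h p q (rfl | ⟨hp, hq, hpq⟩)
    · rfl
    · have := h _ _ hpq
      rwa [hm, hm] at this
  · intro h a b hab
    rw [hm, hm]
    exact h a b ((natRel_coe π a b).2 hab)

end Finpartition

theorem sort_map_val {n : ℕ} (V : Finset (Fin n)) (Q : ℕ → Prop) [DecidablePred Q]
    (hQ : ∀ j : Fin n, Q j ↔ j ∈ V) :
    (List.Ico 0 n).filter (fun i => Q i) = (V.sort (· ≤ ·)).map Fin.val := by
  refine List.Perm.eq_of_pairwise' (r := (· < ·)) ?_ ?_ ?_
  · exact (List.Ico.pairwise_lt 0 n).filter _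
  · rw [List.pairwise_map]
    exact (Finset.sortedLT_sort V).pairwise
  · rw [List.perm_ext_iff_of_nodup ((List.Ico.nodup 0 n).filter _)
      ((Finset.sort_nodup V (· ≤ ·)).map Fin.val_injective)]
    intro a
    simp only [List.mem_filter, List.Ico.mem, decide_eq_true_eq, List.mem_map, Finset.mem_sort]
    constructor
    · rintro ⟨⟨-, h⟩, hq⟩
      exact ⟨⟨a, h⟩, (hQ ⟨a, h⟩).1 hq, rfl⟩
    · rintro ⟨j, hj, rfl⟩
      exact ⟨⟨Nat.zero_le _, j.2⟩, (hQ j).2 hj⟩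

theorem unital_subword (f : Series s R) (w : Word s) (x : ℕ → Fin s)
    (hx : ∀ i : Fin w.1.length, x i = w.1.get i) (V : Finset (Fin w.1.length)) (hV : V.Nonempty)
    (Q : ℕ → Prop) (hQ : ∀ j : Fin w.1.length, Q j ↔ j ∈ V) :
    unital f (subword x Q 0 w.1.length) = f (restrict w V hV) := by
  classical
  have h : subword x Q 0 w.1.length = (restrict w V hV).1 := by
    unfold subword restrict
    refine (congrArg (List.map x) ?_).trans (b := ((V.sort (· ≤ ·)).map Fin.val).map x) ?_
    · rw [← sort_map_val V Q hQ]
    · rw [List.map_map]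
      exact List.map_congr_left fun i _ => hx i
  rw [h, unital_coe]

open Classical in
-- A product over blocks becomes a product over positions once `P` selects one element of each
-- block: the least for `π`, the greatest for its complement, as in the weights.
theorem blockCoeff_eq_prod (f : Series s R) (w : Word s) (x : ℕ → Fin s)
    (hx : ∀ i : Fin w.1.length, x i = w.1.get i)
    (σ : Finpartition (Finset.univ : Finset (Fin w.1.length))) (Q : ℕ → ℕ → Prop)
    (hQ : ∀ i j : Fin w.1.length, Q i j ↔ SameBlock σ i j) (P : ℕ → Prop)
    (hP : ∀ V ∈ σ.parts, ∃ i ∈ V, ∀ j ∈ V, (P j ↔ j = i)) :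
    blockCoeff f w σ = ∏ i ∈ Finset.Ico 0 w.1.length,
      if P i then unital f (subword x (Q i) 0 w.1.length) else 1 := by
  choose pick hpick hpick' using hP
  rw [← Finset.prod_filter, blockCoeff]
  refine Finset.prod_bij (fun V _ => (pick V.1 V.2 : ℕ)) ?_ ?_ ?_ ?_
  · intro V _
    rw [Finset.mem_filter, Finset.mem_Ico]
    exact ⟨⟨Nat.zero_le _, (pick V.1 V.2).2⟩, (hpick' V.1 V.2 _ (hpick V.1 V.2)).2 rfl⟩
  · intro V _ W _ h
    have h1 := hpick W.1 W.2
    rw [← Fin.ext h] at h1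
    exact Subtype.ext (σ.eq_of_mem_parts V.2 W.2 (hpick V.1 V.2) h1)
  · intro i hi
    rw [Finset.mem_filter, Finset.mem_Ico] at hi
    have hm := σ.mem_part (Finset.mem_univ ⟨i, hi.1.2⟩)
    have hp := σ.part_mem.2 (Finset.mem_univ ⟨i, hi.1.2⟩)
    exact ⟨⟨_, hp⟩, Finset.mem_attach _ _,
      (congrArg Fin.val ((hpick' _ hp ⟨i, hi.1.2⟩ hm).1 hi.2)).symm⟩
  · intro V _
    exact (unital_subword f w x hx V.1 _ _ fun j => (hQ _ j).trans
      (sameBlock_iff_of_mem V.2 (hpick V.1 V.2))).symm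

theorem blockCoeff_eq_weightL (f : Series s R) (w : Word s) (x : ℕ → Fin s)
    (hx : ∀ i : Fin w.1.length, x i = w.1.get i)
    (π : Finpartition (Finset.univ : Finset (Fin w.1.length)))
    (hπ : NonCrossingRel (SameBlock π)) :
    blockCoeff f w π = weightL (unital f) x (natRel π) 0 w.1.length [] := by
  classical
  rw [weightL_nil _ x (unital_nil f) (isNCRel_natRel π hπ), blockCoeff_eq_prod f w x hx π
    (natRel π) (natRel_coe π) (fun i => ∀ j, natRel π i j → i ≤ j)]
  · rfl
  · intro V hV
    have hne := π.nonempty_of_mem_parts hV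
    refine ⟨V.min' hne, V.min'_mem hne, fun j hj => ⟨fun h => ?_, ?_⟩⟩
    · refine le_antisymm ?_ (V.min'_le j hj)
      exact h _ ((natRel_coe π _ _).2 ⟨V, hV, hj, V.min'_mem hne⟩)
    · rintro rfl k (h | ⟨_, hk, h⟩)
      · exact h.le
      · exact V.min'_le ⟨k, hk⟩ ((sameBlock_iff_of_mem hV hj).1 h)

theorem blockCoeff_kreweras_eq_weightR (f : Series s R) (w : Word s) (x : ℕ → Fin s)
    (hx : ∀ i : Fin w.1.length, x i = w.1.get i)
    (π : Finpartition (Finset.univ : Finset (Fin w.1.length))) :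
    blockCoeff f w (kreweras π) = weightR (unital f) x (natRel π) 0 w.1.length [] := by
  classical
  rw [weightR_nil _ x (List.length_pos_of_ne_nil w.2), blockCoeff_eq_prod f w x hx (kreweras π)
    (krew (natRel π)) (fun i j => (sameBlock_kreweras_iff π i j).symm)
    (fun i => ∀ j, i < j → j < w.1.length → ¬krew (natRel π) i j)]
  · rfl
  · intro V hV
    have hne := (kreweras π).nonempty_of_mem_parts hV
    refine ⟨V.max' hne, V.max'_mem hne, fun j hj => ⟨fun h => ?_, ?_⟩⟩
    · refine le_antisymm (V.le_max' j hj) ?_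
      by_contra hlt
      exact h _ (not_le.1 hlt) (V.max' hne).2
        ((sameBlock_kreweras_iff π _ _).1 ⟨V, hV, hj, V.max'_mem hne⟩)
    · rintro rfl k hk hk' h
      have h1 := (sameBlock_iff_of_mem hV hj).1
        ((sameBlock_kreweras_iff π (V.max' hne) ⟨k, hk'⟩).2 h)
      exact absurd (V.le_max' _ h1) (not_le.2 hk)

theorem boxConv_eq_box (f g : Series s R) :
    unital (boxConv f g) = box (unital f) (unital g) := by
  classical
  ext w
  by_cases hw : w = []
  · subst hw
    exact (box_nil _ _ (unital_nil f) (unital_nil g)).symm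
  -- The default letter is never read inside the word.
  let x : ℕ → Fin s := fun i => w.getD i (w.head hw)
  have hx : ∀ i : Fin w.length, x i = w.get i := fun i => by simp [x]
  have hmap : (List.Ico 0 w.length).map x = w := by
    refine List.ext_get (by simp) fun i h1 h2 => ?_
    simp [List.Ico, x, h2]
  have h := ncSum_eq_ncRec (unital f) (unital g) x (unital_nil f) 0 w.length [] []
  rw [hmap] at h
  refine (unital_coe (boxConv f g) ⟨w, hw⟩).trans (Eq.trans ?_ h)
  unfold boxConv ncSum
  refine Finset.sum_bij (fun π _ => natRel π) ?_ ?_ ?_ ?_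
  · intro π hπ
    rw [mem_ncRels]
    unfold NC at hπ
    exact isNCRel_natRel π (Finset.mem_filter.1 hπ).2
  · intro π _ σ _ h
    have hiff : ∀ i j, SameBlock π i j ↔ SameBlock σ i j := fun i j => by
      rw [← natRel_coe, ← natRel_coe]
      exact iff_of_eq (congrFun (congrFun h _) _)
    exact le_antisymm (le_of_sameBlock fun i j => (hiff i j).1)
      (le_of_sameBlock fun i j => (hiff i j).2)
  · intro r hr
    rw [mem_ncRels] at hr
    let t : Setoid (Fin w.length) := ⟨fun i j => r i j, fun i => hr.refl i, fun h => hr.symm _ _ h,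
      fun h h' => hr.trans _ _ _ h h'⟩
    have ht : ∀ i j, SameBlock (Finpartition.ofSetoid t) i j ↔ r i j := sameBlock_ofSetoid t
    refine ⟨Finpartition.ofSetoid t, ?_, ?_⟩
    · unfold NC
      refine Finset.mem_filter.2 ⟨Finset.mem_univ _, fun a b c d h1 h2 h3 => ?_⟩
      rw [ht, ht, ht]
      exact hr.nonCrossing a b c d h1 h2 h3
    · funext i j
      rw [eq_iff_iff]
      constructor
      · rintro (rfl | ⟨hi, hj, h⟩)
        · exact hr.refl i
        · exact (ht _ _).1 h
      · intro h
        by_cases hij : i = j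
        · exact Or.inl hij
        · have := hr.support i j h hij
          exact Or.inr ⟨this.2.1, this.2.2.2, (ht ⟨i, _⟩ ⟨j, _⟩).2 h⟩
  · intro π hπ
    unfold NC at hπ
    rw [blockCoeff_eq_weightL f ⟨w, hw⟩ x hx π (Finset.mem_filter.1 hπ).2,
      blockCoeff_kreweras_eq_weightR g ⟨w, hw⟩ x hx π]

/-! ### The monoid of boxed convolution and the Möbius series -/

theorem boxConv_assoc (f g k : Series s R) :
    boxConv (boxConv f g) k = boxConv f (boxConv g k) :=
  unital_injective (by
    simp only [boxConv_eq_box]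
    exact box_assoc _ _ _ (unital_nil f) (unital_nil g) (unital_nil k))

theorem boxConv_one (f : Series s R) : boxConv f (boxOne s R) = f :=
  unital_injective (by rw [boxConv_eq_box, unital_boxOne, box_one _ (unital_nil f)])

theorem one_boxConv (f : Series s R) : boxConv (boxOne s R) f = f :=
  unital_injective (by rw [boxConv_eq_box, unital_boxOne, one_box])

theorem existsUnique_moebius : ∃! M : Series s R, IsBoxInverse (zeta s R) M := by
  obtain ⟨M, hM, h1, h2⟩ := exists_box_inverse_ones (α := Fin s) (R := R)
  obtain ⟨M, rfl⟩ := exists_unital_eq M hM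
  rw [← unital_zeta, ← boxConv_eq_box, ← unital_boxOne] at h1 h2
  replace h1 := unital_injective h1
  replace h2 := unital_injective h2
  refine ⟨M, ⟨h1, h2⟩, fun M' h' => ?_⟩
  rw [← one_boxConv M', ← h2, boxConv_assoc, h'.1, boxConv_one]

/-! ### Functionals on monomials and the main identity -/

theorem basisFreeMonoid_apply {α : Type*} (u : FreeMonoid α) :
    FreeAlgebra.basisFreeMonoid R α u = monomial R u.toList := by
  have h : FreeAlgebra.basisFreeMonoid R α u =
      FreeAlgebra.equivMonoidAlgebraFreeMonoid.symm (MonoidAlgebra.of R (FreeMonoid α) u) := rfl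
  rw [h]
  clear h
  induction u using FreeMonoid.inductionOn' with
  | one => rw [map_one, map_one]; rfl
  | of_mul a u ih =>
    rw [map_mul, map_mul, ih, FreeMonoid.toList_of_mul]
    change _ = ((a :: FreeMonoid.toList u).map (FreeAlgebra.ι R)).prod
    rw [List.map_cons, List.prod_cons]
    congr 1
    simp [FreeAlgebra.equivMonoidAlgebraFreeMonoid]

theorem functional_monomial (f : Series s R) (a : List (Fin s)) :
    functional f (monomial R a) = unital f a := by
  have h := basisFreeMonoid_apply (R := R) (FreeMonoid.ofList a)
  rw [FreeMonoid.toList_ofList] at h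
  rw [← h, functional, Module.Basis.constr_basis]
  rfl

theorem comulM_monomial (a : List (Fin s)) :
    comulM s R (monomial R a) = monomial R (double a) := by
  induction a with
  | nil => simp [monomial, double]
  | cons i a ih =>
    rw [monomial, List.map_cons, List.prod_cons, map_mul, ← monomial, ih, comulM,
      FreeAlgebra.lift_ι_apply]
    simp [double, monomial, mul_assoc]

theorem freeProduct_monomial (f g : FreeAlgebra R (Fin s) →ₗ[R] R) (a : List (Fin s ⊕ Fin s)) :
    freeProduct f g (monomial R a) =
      freeValue f g (a.map (Sum.map (FreeAlgebra.ι R) (FreeAlgebra.ι R))) := by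
  have h := basisFreeMonoid_apply (R := R) (FreeMonoid.ofList a)
  rw [FreeMonoid.toList_ofList] at h
  rw [← h, freeProduct, Module.Basis.constr_basis]
  rfl

/-- Take the cumulants `κ = f ⊠ M`, so that `κ ⊠ Zeta = f`. The series `freeMoment` then has the
restrictions `f` and `g` and vanishing centered products, hence equals the free product; along
doubled words it is `κ ⊠ g`. -/
theorem freeProduct_comp_comulM {M : Series s R} (hM : IsBoxInverse (zeta s R) M)
    (f g : Series s R) :
    freeProduct (functional f) (functional g) ∘ₗ (comulM s R).toLinearMap
      = functional (boxConv (boxConv f M) g) := by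
  refine (FreeAlgebra.basisFreeMonoid R (Fin s)).ext fun u => ?_
  rw [basisFreeMonoid_apply, functional_monomial, LinearMap.comp_apply, AlgHom.toLinearMap_apply,
    comulM_monomial, freeProduct_monomial]
  set κ := boxConv f M with hκ
  have hf : box (unital κ) (ones (Fin s) R) = unital f := by
    rw [← unital_zeta, ← boxConv_eq_box, hκ, boxConv_assoc, hM.2, boxConv_one]
  set G := freeMoment (unital κ) (unital g) [] with hG
  have key := freeValue_eq_of_centered (G := G)
    ((freeMoment_nil _ _ _).trans (unital_nil g))
    (centered_freeMoment (unital κ) (unital g) (unital_nil g)) (functional f) (functional g)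
    (fun a => by
      rw [functional_monomial, hG, freeMoment_map_inl _ _ (unital_nil g) (unital_nil κ), hf])
    (fun a => by rw [functional_monomial, hG, freeMoment_map_inr])
    -- Each letter is taken as a separate factor; grouping into an alternating product happens
    -- inside `freeValue`.
    ((double u.toList).map (Sum.map (fun i => [i]) fun i => [i]))
  have h1 : ((double u.toList).map (Sum.map (fun i => [i]) fun i => [i])).map (itemMonomial R) =
      (double u.toList).map (Sum.map (FreeAlgebra.ι R) (FreeAlgebra.ι R)) := by
    rw [List.map_map]
    refine List.map_congr_left fun z _ => ?_
    cases z <;> simp [itemMonomial, monomial]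
  have h2 : ((double u.toList).map (Sum.map (fun i => [i]) fun i => [i])).flatMap itemWord =
      double u.toList := by
    induction double u.toList with
    | nil => rfl
    | cons z l ih => rw [List.map_cons, List.flatMap_cons, ih]; cases z <;> rfl
  rw [h1, h2] at key
  rw [key, boxConv_eq_box, ← alongDouble_freeMoment _ _ (unital_nil κ)]
  rfl

end FreeConv

open FreeConv
theorem mainTheorem3 (s : ℕ) (R : Type*) [CommRing R] :
    (∃! M : Series s R, IsBoxInverse (zeta s R) M) ∧
    ∀ M : Series s R, IsBoxInverse (zeta s R) M →
      ∀ f ∈ unitSeries s R, ∀ g ∈ unitSeries s R,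
        freeProduct (functional f) (functional g) ∘ₗ (comulM s R).toLinearMap
            = functional (boxConv (boxConv f M) g) ∧
          boxConv (boxConv f M) g = boxConv f (boxConv M g) :=
  ⟨existsUnique_moebius, fun _ hM f _ g _ =>
    ⟨freeProduct_comp_comulM hM f g, boxConv_assoc f _ g⟩⟩
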